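/- Let $K$ be a locally compact hypergroup (in the sense of Jewett) with involution $x\mapsto x^-$, and write $f(x*y):=\int_K f\,d(\delta_x*\delta_y)$. Let $\lambda$ be a left-invariant measure on $K$, i.e. a non-negative Radon measure with $\delta_x*\lambda=\lambda$ for all $x\in K$. Let $w$ be a weight on $K$, i.e. a positive continuous function with $w(x*y)\le w(x)w(y)$ for all $x,y\in K$, let $\Phi:\mathbb R\to[0,\infty)$ be a Young function (convex, even, $\Phi(0)=0$, $\lim_{x\to\infty}\Phi(x)=\infty$) with complementary function $\Psi(x)=\sup\{y|x|-\Phi(y):y\ge 0\}$, and let $g\in C_c(K)$. Let $L^1_w(K)$ be the space of (classes of) measurable $f$ with $\|f\|_{1,w}=\int_K|f|\,w\,d\lambda<\infty$; let $M_w(K)$ be the space of bounded complex Radon measures $\mu$ on $K$ for which $w\mu$ is again bounded, with $\|\mu\|_w=\|w\mu\|=\int_K w\,d|\mu|$; and let $L^\Phi_w(K)$ be the space of (classes of) measurable $f$ with $\int_K\Phi(\alpha\, w|f|)\,d\lambda<\infty$ for some $\alpha>0$, with the Orlicz norm $\|f\|_{\Phi,w}=\sup\{\int_K w|fv|\,d\lambda:\int_K\Psi(|v|)\,d\lambda\le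 1\}$. Put $$(f*g)(x)=\int_K f(y)\,g(y^-*x)\,d\lambda(y),\qquad (\mu*g)(x)=\int_K g(y^-*x)\,d\mu(y).$$ Then $T_g: f\mapsto f*g$ is a (well-defined, bounded linear) compact operator from $L^1_w(K)$ to $L^\Phi_w(K)$ if and only if $\tilde T_g:\mu\mapsto\mu*g$ is a (well-defined, bounded linear) compact operator from $M_w(K)$ to $L^\Phi_w(K)$. -/

import Mathlib

open MeasureTheory Topology Filter Set
open scoped ENNReal NNReal

noncomputable section

/-! ### Bounded complex Radon measures -/

/-- A measure dominated by a finite Radon measure is a Radon measure. -/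
theorem regular_of_le {K : Type*} [TopologicalSpace K] [T2Space K] [MeasurableSpace K]
    [BorelSpace K] {m n : Measure K} [IsFiniteMeasure m] [IsFiniteMeasure n]
    [n.InnerRegularCompactLTTop] (h : m ≤ n) : m.Regular := by
  have : m.InnerRegularCompactLTTop := by
    constructor
    rintro A ⟨hA, -⟩ r hr
    have hpos : m A - r ≠ 0 := (tsub_pos_of_lt hr).ne'
    obtain ⟨C, hCA, hC, hlt⟩ := hA.exists_isCompact_sdiff_lt (μ := n) (measure_ne_top _ _) hpos
    refine ⟨C, hCA, hC, ?_⟩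
    by_contra hle
    rw [not_lt] at hle
    have h1 : m (A \ C) < m A - r := (h _).trans_lt hlt
    have h2 : m A ≤ m C + m (A \ C) := by
      calc m A ≤ m (C ∪ A \ C) := measure_mono (by simp)
        _ ≤ _ := measure_union_le _ _
    have h3 : m A < m A := by
      calc m A ≤ m C + m (A \ C) := h2
        _ ≤ r + m (A \ C) := by gcongr
        _ < r + (m A - r) := ENNReal.add_lt_add_left (ne_top_of_lt hr) h1
        _ = m A := add_tsub_cancel_of_le hr.le
    exact lt_irrefl _ h3
  infer_instance

/-- `M(K)`: the bounded complex Radon measures on `K`, i.e. the complex Borel measures whose total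
variation is a finite Radon measure. -/
def radonMeasures (K : Type*) [TopologicalSpace K] [T2Space K] [MeasurableSpace K]
    [BorelSpace K] : Submodule ℂ (ComplexMeasure K) where
  carrier := {μ | IsFiniteMeasure μ.variation ∧ μ.variation.Regular}
  zero_mem' := by
    simp only [mem_ofPred_eq, VectorMeasure.variation_zero]
    exact ⟨inferInstance, inferInstance⟩
  add_mem' := by
    rintro μ ν ⟨h1, h2⟩ ⟨h3, h4⟩
    have hle := VectorMeasure.variation_add_le (μ := μ) (ν := ν)
    have hf : IsFiniteMeasure (μ + ν).variation := isFiniteMeasure_of_le _ hle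
    exact ⟨hf, regular_of_le hle⟩
  smul_mem' := by
    rintro c μ ⟨h1, h2⟩
    simp only [mem_ofPred_eq, VectorMeasure.variation_smul]
    exact ⟨inferInstance, inferInstance⟩

/-- The Dirac measure `δ_x` as an element of `M(K)`. -/
def diracRadon {K : Type*} [TopologicalSpace K] [T2Space K] [MeasurableSpace K]
    [BorelSpace K] (x : K) : radonMeasures K :=
  ⟨VectorMeasure.dirac x 1, inferInstance, by
    have hD : (Measure.dirac x).Regular := by
      have : (Measure.dirac x).InnerRegularCompactLTTop := by
        constructor
        rintro A ⟨hA, -⟩ r hr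
        by_cases hx : x ∈ A
        · refine ⟨{x}, by simpa using hx, isCompact_singleton, hr.trans_le ?_⟩
          simp [Measure.dirac_apply' x hA, hx]
        · simp [Measure.dirac_apply' x hA, hx] at hr
      infer_instance
    simpa using hD⟩

/-- A complex measure is nonnegative if all its values are nonnegative real numbers. -/
def IsNonnegMeasure {K : Type*} [MeasurableSpace K] (μ : ComplexMeasure K) : Prop :=
  ∀ E : Set K, 0 ≤ (μ E).re ∧ (μ E).im = 0

/-- `M⁺(K)`: the nonnegative elements of `M(K)`. -/
abbrev PosRadon (K : Type*) [TopologicalSpace K] [T2Space K] [MeasurableSpace K]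
    [BorelSpace K] : Type _ :=
  {μ : radonMeasures K // IsNonnegMeasure (μ : ComplexMeasure K)}

/-- The cone topology on `M⁺(K)`: the weakest topology for which `μ ↦ ∫ f dμ` is continuous for
every nonnegative `f ∈ C_c(K)` and for `f = 1`. A nonnegative measure equals its variation. -/
instance PosRadon.coneTopology (K : Type*) [TopologicalSpace K] [T2Space K] [MeasurableSpace K]
    [BorelSpace K] : TopologicalSpace (PosRadon K) :=
  TopologicalSpace.induced
    (fun (μ : PosRadon K) (f : {f : C(K, ℝ) // (HasCompactSupport f ∧ ∀ x, 0 ≤ f x) ∨ f = 1}) =>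
      ∫ x, f.1 x ∂(μ.1 : ComplexMeasure K).variation)
    inferInstance

/-! ### Hypergroups -/

/-- A (locally compact) hypergroup in the sense of Jewett, on a locally compact Hausdorff space with
its Borel σ-algebra. Since `δ_x * δ_y` is nonnegative, its total variation is `δ_x * δ_y` itself,
regarded as a positive measure. -/
class Hypergroup (K : Type*) [TopologicalSpace K] [T2Space K] [LocallyCompactSpace K]
    [MeasurableSpace K] [BorelSpace K] where
  /-- the convolution of `M(K)` -/
  conv : radonMeasures K →ₗ[ℂ] radonMeasures K →ₗ[ℂ] radonMeasures K
  /-- the involution `x ↦ x⁻` -/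
  inv : K → K
  /-- the identity element `e` -/
  one : K
  conv_assoc : ∀ μ ν ρ : radonMeasures K, conv (conv μ ν) ρ = conv μ (conv ν ρ)
  norm_conv_le : ∀ μ ν : radonMeasures K,
    (conv μ ν : ComplexMeasure K).variation univ ≤
      (μ : ComplexMeasure K).variation univ * (ν : ComplexMeasure K).variation univ
  conv_nonneg : ∀ μ ν : radonMeasures K, IsNonnegMeasure (μ : ComplexMeasure K) →
    IsNonnegMeasure (ν : ComplexMeasure K) → IsNonnegMeasure (conv μ ν : ComplexMeasure K)
  continuous_conv : Continuous (fun p : PosRadon K × PosRadon K =>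
    (⟨conv p.1.1 p.2.1, conv_nonneg p.1.1 p.2.1 p.1.2 p.2.2⟩ : PosRadon K))
  dirac_conv_prob : ∀ x y : K, IsProbabilityMeasure
    (conv (diracRadon x) (diracRadon y) : ComplexMeasure K).variation
  /-- The supports of `δ_x * δ_y` are nonempty compact sets that depend continuously on `(x, y)`;
  `NonemptyCompacts K` carries the Vietoris (= Michael) topology. -/
  continuous_support : ∃ S : K × K → TopologicalSpace.NonemptyCompacts K, Continuous S ∧
    ∀ x y : K, (S (x, y) : Set K) =
      (conv (diracRadon x) (diracRadon y) : ComplexMeasure K).variation.support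
  one_conv : ∀ x : K, conv (diracRadon one) (diracRadon x) = diracRadon x
  conv_one : ∀ x : K, conv (diracRadon x) (diracRadon one) = diracRadon x
  continuous_inv : Continuous inv
  inv_inv : ∀ x : K, inv (inv x) = x
  /-- `(δ_x * δ_y)⁻ = δ_{y⁻} * δ_{x⁻}`, where `μ⁻(E) = μ {x⁻ | x ∈ E}` -/
  dirac_conv_inv : ∀ (x y : K) (E : Set K), MeasurableSet E →
    (conv (diracRadon x) (diracRadon y) : ComplexMeasure K) (inv '' E) =
      (conv (diracRadon (inv y)) (diracRadon (inv x)) : ComplexMeasure K) E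
  one_mem_support_iff : ∀ x y : K,
    one ∈ (conv (diracRadon x) (diracRadon y) : ComplexMeasure K).variation.support ↔ x = inv y

namespace Hypergroup

variable {K : Type*} [TopologicalSpace K] [T2Space K] [LocallyCompactSpace K]
  [MeasurableSpace K] [BorelSpace K] [Hypergroup K]

/-- The probability measure `δ_x * δ_y`. -/
def pointConv (x y : K) : Measure K :=
  (conv (diracRadon x) (diracRadon y) : ComplexMeasure K).variation

/-- `f(x * y) = ∫ f d(δ_x * δ_y)`. -/
def evalConv {E : Type*} [NormedAddCommGroup E] [NormedSpace ℝ E] (f : K → E) (x y : K) : E :=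
  ∫ t, f t ∂(pointConv x y)

/-- `δ_x * lam = lam` for all `x`, tested on `C_c(K)`. -/
def IsLeftInvariant (lam : Measure K) : Prop :=
  ∀ (x : K) (f : K → ℝ), Continuous f → HasCompactSupport f →
    ∫ y, evalConv f x y ∂lam = ∫ y, f y ∂lam

variable (K) in
/-- A weight: a positive continuous function with `w(x * y) ≤ w(x) w(y)`. -/
structure Weight where
  toFun : K → ℝ
  continuous_toFun : Continuous toFun
  pos : ∀ x, 0 < toFun x
  submul : ∀ x y, evalConv toFun x y ≤ toFun x * toFun y

instance : CoeFun (Weight K) (fun _ => K → ℝ) := ⟨Weight.toFun⟩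

/-- `M_w(K)`: the measures `μ ∈ M(K)` with `w μ ∈ M(K)`, i.e. `∫ w d|μ| < ∞`. -/
def weightedMeasures (w : Weight K) : Submodule ℂ (ComplexMeasure K) where
  carrier := {μ | μ ∈ radonMeasures K ∧ ∫⁻ x, ENNReal.ofReal (w x) ∂μ.variation < ∞}
  zero_mem' := ⟨zero_mem _, by simp⟩
  add_mem' := by
    rintro μ ν ⟨h1, h2⟩ ⟨h3, h4⟩
    refine ⟨add_mem h1 h3, ?_⟩
    calc _ ≤ ∫⁻ x, ENNReal.ofReal (w x) ∂(μ.variation + ν.variation) :=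
          lintegral_mono' VectorMeasure.variation_add_le le_rfl
      _ < ∞ := by
          rw [lintegral_add_measure]
          exact ENNReal.add_lt_top.2 ⟨h2, h4⟩
  smul_mem' := by
    rintro c μ ⟨h1, h2⟩
    refine ⟨Submodule.smul_mem _ c h1, ?_⟩
    rw [VectorMeasure.variation_smul, lintegral_smul_measure]
    exact ENNReal.mul_lt_top ENNReal.coe_lt_top h2

/-- The norm `‖μ‖_w = ‖w μ‖ = ∫ w d|μ|` of `M_w(K)`. -/
instance (w : Weight K) : Norm (weightedMeasures w) :=
  ⟨fun μ => (∫⁻ x, ENNReal.ofReal (w x) ∂(μ : ComplexMeasure K).variation).toReal⟩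

theorem weightedMeasures_norm_def (w : Weight K) (μ : weightedMeasures w) :
    ‖μ‖ = (∫⁻ x, ENNReal.ofReal (w x) ∂(μ : ComplexMeasure K).variation).toReal := rfl

theorem weightedMeasures_core (w : Weight K) :
    SeminormedSpace.Core ℂ (weightedMeasures w) where
  norm_nonneg μ := ENNReal.toReal_nonneg
  norm_smul c μ := by
    simp only [weightedMeasures_norm_def, Submodule.coe_smul, VectorMeasure.variation_smul]
    rw [lintegral_smul_measure]
    simp [ENNReal.smul_def]
  norm_triangle μ ν := by
    simp only [weightedMeasures_norm_def, Submodule.coe_add]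
    rw [← ENNReal.toReal_add μ.2.2.ne ν.2.2.ne]
    refine ENNReal.toReal_mono (ENNReal.add_ne_top.2 ⟨μ.2.2.ne, ν.2.2.ne⟩) ?_
    rw [← lintegral_add_measure]
    exact lintegral_mono' VectorMeasure.variation_add_le le_rfl

instance (w : Weight K) : SeminormedAddCommGroup (weightedMeasures w) :=
  SeminormedAddCommGroup.ofCore (weightedMeasures_core w)

instance (w : Weight K) : NormedSpace ℂ (weightedMeasures w) where
  norm_smul_le c μ := ((weightedMeasures_core w).norm_smul c μ).le

/-- The weighted space `L^1_w(K)`, with norm `∫ |f| w dlam`. -/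
abbrev WeightedL1 (lam : Measure K) (w : Weight K) : Type _ :=
  Lp ℂ 1 (lam.withDensity (fun x => ENNReal.ofReal (w x)))

end Hypergroup

/-! ### Orlicz spaces -/

/-- A Young function: a convex even function `Φ : ℝ → [0, ∞)` with `Φ(0) = 0` and
`Φ(x) → ∞` as `x → ∞`. -/
structure YoungFunction where
  toFun : ℝ → ℝ
  nonneg : ∀ x, 0 ≤ toFun x
  convex : ConvexOn ℝ univ toFun
  even : ∀ x, toFun (-x) = toFun x
  map_zero : toFun 0 = 0
  tendsto_atTop : Tendsto toFun atTop atTop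

namespace YoungFunction

instance : CoeFun YoungFunction (fun _ => ℝ → ℝ) := ⟨YoungFunction.toFun⟩

/-- The complementary function `Ψ(x) = sup {y|x| - Φ(y) : y ≥ 0}`, with values in `[0, ∞]` (the
value for `y = 0` is `0`). -/
def compl (Φ : YoungFunction) (x : ℝ) : ℝ≥0∞ :=
  ⨆ (y : ℝ) (_ : 0 ≤ y), ENNReal.ofReal (y * |x| - Φ y)

variable (Φ : YoungFunction)

theorem continuous : Continuous Φ.toFun :=
  continuousOn_univ.1 (Φ.convex.continuousOn isOpen_univ)

theorem mono {a b : ℝ} (ha : 0 ≤ a) (hab : a ≤ b) : Φ a ≤ Φ b := by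
  rcases eq_or_lt_of_le (ha.trans hab) with hb | hb
  · have : a = b := by linarith
    rw [this]
  · have h := Φ.convex.2 (mem_univ 0) (mem_univ b) (show 0 ≤ 1 - a / b by rw [sub_nonneg, div_le_one hb]; exact hab)
      (show 0 ≤ a / b by positivity) (by ring)
    simp only [smul_eq_mul, mul_zero, zero_add, Φ.map_zero] at h
    rw [div_mul_cancel₀ _ hb.ne'] at h
    refine h.trans (mul_le_of_le_one_left (Φ.nonneg b) ?_)
    rw [div_le_one hb]; exact hab

theorem half_add {a b : ℝ} : Φ ((a + b) / 2) ≤ (Φ a + Φ b) / 2 := by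
  have h := Φ.convex.2 (mem_univ a) (mem_univ b) 
    (show (0 : ℝ) ≤ 1 / 2 by norm_num) (show (0 : ℝ) ≤ 1 / 2 by norm_num) (by norm_num)
  simp only [smul_eq_mul] at h
  have e : (a + b) / 2 = 1 / 2 * a + 1 / 2 * b := by ring
  rw [e]
  linarith

theorem young {a b : ℝ} (ha : 0 ≤ a) (hb : 0 ≤ b) :
    ENNReal.ofReal (a * b) ≤ ENNReal.ofReal (Φ a) + Φ.compl b := by
  have h1 : ENNReal.ofReal (a * |b| - Φ a) ≤ Φ.compl b :=
    le_iSup₂ (f := fun (y : ℝ) (_ : 0 ≤ y) => ENNReal.ofReal (y * |b| - Φ y)) a ha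
  calc ENNReal.ofReal (a * b) = ENNReal.ofReal (Φ a + (a * |b| - Φ a)) := by
        rw [abs_of_nonneg hb]; ring_nf
    _ ≤ _ := ENNReal.ofReal_add_le
    _ ≤ _ := by gcongr

end YoungFunction

namespace Hypergroup

variable {K : Type*} [TopologicalSpace K] [T2Space K] [LocallyCompactSpace K]
  [MeasurableSpace K] [BorelSpace K] [Hypergroup K]

/-- `L^Φ_w(K) = {f : w f ∈ L^Φ(K)}`, i.e. the classes of measurable `f : K → ℂ`, modulo equality
`lam`-almost everywhere, with `∫ Φ(α |w f|) dlam < ∞` for some `α > 0`. -/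
def weightedOrlicz (lam : Measure K) (Φ : YoungFunction) (w : Weight K) :
    Submodule ℂ (K →ₘ[lam] ℂ) where
  carrier := {f | ∃ α : ℝ, 0 < α ∧ ∫⁻ x, ENNReal.ofReal (Φ (α * (w x * ‖f x‖))) ∂lam < ∞}
  zero_mem' := by
    refine ⟨1, one_pos, ?_⟩
    have h : (fun x => ENNReal.ofReal (Φ (1 * (w x * ‖(0 : K →ₘ[lam] ℂ) x‖)))) =ᵐ[lam] 0 := by
      filter_upwards [AEEqFun.coeFn_zero (μ := lam) (β := ℂ) (α := K)] with x hx
      simp [hx, Φ.map_zero]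
    rw [lintegral_congr_ae h]
    simp
  add_mem' := by
    rintro f g ⟨α, hα, hf⟩ ⟨β, hβ, hg⟩
    have hγ : 0 < min α β := lt_min hα hβ
    refine ⟨min α β / 2, by positivity, ?_⟩
    have hmeas : AEMeasurable (fun x => ENNReal.ofReal (Φ (α * (w x * ‖f x‖)))) lam :=
      (Φ.continuous.measurable.comp_aemeasurable ((w.continuous_toFun.measurable.aemeasurable.mul
        f.aestronglyMeasurable.norm.aemeasurable).const_mul α)).ennreal_ofReal
    refine lt_of_le_of_lt (b := ∫⁻ x, (ENNReal.ofReal (Φ (α * (w x * ‖f x‖))) +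
      ENNReal.ofReal (Φ (β * (w x * ‖g x‖)))) ∂lam) ?_ ?_
    · refine lintegral_mono_ae ?_
      filter_upwards [AEEqFun.coeFn_add f g] with x hx
      have hw := (w.pos x).le
      rw [← ENNReal.ofReal_add (Φ.nonneg _) (Φ.nonneg _)]
      refine ENNReal.ofReal_le_ofReal ?_
      have h1 : min α β / 2 * (w x * ‖(f + g) x‖) ≤
          (α * (w x * ‖f x‖) + β * (w x * ‖g x‖)) / 2 := by
        rw [hx]
        have hn : ‖(⇑f + ⇑g) x‖ ≤ ‖f x‖ + ‖g x‖ := norm_add_le _ _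
        have e1 : min α β * (w x * ‖f x‖) ≤ α * (w x * ‖f x‖) := by
          gcongr; exact min_le_left _ _
        have e2 : min α β * (w x * ‖g x‖) ≤ β * (w x * ‖g x‖) := by
          gcongr; exact min_le_right _ _
        have e3 : min α β * (w x * ‖(⇑f + ⇑g) x‖) ≤ min α β * (w x * (‖f x‖ + ‖g x‖)) := by
          gcongr
        linarith
      refine (Φ.mono (by positivity) h1).trans (Φ.half_add.trans ?_)
      have := Φ.nonneg (α * (w x * ‖f x‖))
      have := Φ.nonneg (β * (w x * ‖g x‖))
      linarith
    · rw [lintegral_add_left' hmeas]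
      exact ENNReal.add_lt_top.2 ⟨hf, hg⟩
  smul_mem' := by
    rintro c f ⟨α, hα, hf⟩
    refine ⟨α / (‖c‖ + 1), by positivity, lt_of_le_of_lt (lintegral_mono_ae ?_) hf⟩
    filter_upwards [AEEqFun.coeFn_smul c f] with x hx
    have hw := (w.pos x).le
    refine ENNReal.ofReal_le_ofReal (Φ.mono (by positivity) ?_)
    rw [hx, Pi.smul_apply, norm_smul]
    have h : ‖c‖ / (‖c‖ + 1) ≤ 1 := by
      rw [div_le_one (by positivity)]; linarith
    calc α / (‖c‖ + 1) * (w x * (‖c‖ * ‖f x‖))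
        = ‖c‖ / (‖c‖ + 1) * (α * (w x * ‖f x‖)) := by ring
      _ ≤ α * (w x * ‖f x‖) := mul_le_of_le_one_left (by positivity) h

/-- The Orlicz norm `‖f‖_{Φ,w} = ‖w f‖_Φ = sup {∫ |w f v| dlam : ∫ Ψ(|v|) dlam ≤ 1}`. -/
def orliczNorm (lam : Measure K) (Φ : YoungFunction) (w : Weight K) (f : K → ℂ) : ℝ≥0∞ :=
  ⨆ (v : K → ℂ) (_ : Measurable v) (_ : ∫⁻ x, Φ.compl ‖v x‖ ∂lam ≤ 1),
    ∫⁻ x, ENNReal.ofReal (w x * ‖f x‖ * ‖v x‖) ∂lam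

variable {lam : Measure K} {Φ : YoungFunction} {w : Weight K}

theorem orliczNorm_congr {f g : K → ℂ} (h : f =ᵐ[lam] g) :
    orliczNorm lam Φ w f = orliczNorm lam Φ w g := by
  unfold orliczNorm
  refine iSup_congr fun v => iSup_congr fun hv => iSup_congr fun hv' => lintegral_congr_ae ?_
  filter_upwards [h] with x hx
  rw [hx]

theorem orliczNorm_ne_top (f : weightedOrlicz lam Φ w) :
    orliczNorm lam Φ w (f : K →ₘ[lam] ℂ) ≠ ∞ := by
  obtain ⟨α, hα, hf⟩ := f.2
  set F : K → ℂ := ⇑(f : K →ₘ[lam] ℂ)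
  have hmeas : AEMeasurable (fun x => ENNReal.ofReal (Φ (α * (w x * ‖F x‖)))) lam :=
    (Φ.continuous.measurable.comp_aemeasurable ((w.continuous_toFun.measurable.aemeasurable.mul
      (f : K →ₘ[lam] ℂ).aestronglyMeasurable.norm.aemeasurable).const_mul α)).ennreal_ofReal
  refine ne_top_of_le_ne_top (b := ENNReal.ofReal α⁻¹ *
    (∫⁻ x, ENNReal.ofReal (Φ (α * (w x * ‖F x‖))) ∂lam + 1)) ?_ ?_
  · exact ENNReal.mul_ne_top ENNReal.ofReal_ne_top (ENNReal.add_ne_top.2 ⟨hf.ne, by simp⟩)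
  · refine iSup_le fun v => iSup_le fun hv => iSup_le fun hv1 => ?_
    calc ∫⁻ x, ENNReal.ofReal (w x * ‖F x‖ * ‖v x‖) ∂lam
        ≤ ∫⁻ x, ENNReal.ofReal α⁻¹ *
          (ENNReal.ofReal (Φ (α * (w x * ‖F x‖))) + Φ.compl ‖v x‖) ∂lam := by
          refine lintegral_mono fun x => ?_
          have hw := (w.pos x).le
          have e : w x * ‖F x‖ * ‖v x‖ = α⁻¹ * (α * (w x * ‖F x‖) * ‖v x‖) := by
            field_simp
          rw [e, ENNReal.ofReal_mul (by positivity)]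
          gcongr
          exact Φ.young (by positivity) (norm_nonneg _)
      _ = ENNReal.ofReal α⁻¹ * (∫⁻ x, ENNReal.ofReal (Φ (α * (w x * ‖F x‖))) ∂lam +
          ∫⁻ x, Φ.compl ‖v x‖ ∂lam) := by
          rw [lintegral_const_mul' _ _ ENNReal.ofReal_ne_top, lintegral_add_left' hmeas]
      _ ≤ _ := by gcongr

theorem orliczNorm_add_le {f g : K → ℂ} (hf : AEStronglyMeasurable f lam) :
    orliczNorm lam Φ w (f + g) ≤ orliczNorm lam Φ w f + orliczNorm lam Φ w g := by
  refine iSup_le fun v => iSup_le fun hv => iSup_le fun hv1 => ?_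
  have hmeas : AEMeasurable (fun x => ENNReal.ofReal (w x * ‖f x‖ * ‖v x‖)) lam :=
    ((w.continuous_toFun.measurable.aemeasurable.mul hf.norm.aemeasurable).mul
      hv.norm.aemeasurable).ennreal_ofReal
  have hle : ∀ h : K → ℂ, ∫⁻ x, ENNReal.ofReal (w x * ‖h x‖ * ‖v x‖) ∂lam ≤
      orliczNorm lam Φ w h := fun h =>
    le_iSup_of_le v (le_iSup_of_le hv (le_iSup_of_le hv1 le_rfl))
  refine le_trans ?_ (add_le_add (hle f) (hle g))
  rw [← lintegral_add_left' hmeas]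
  refine lintegral_mono fun x => ?_
  have hw := (w.pos x).le
  rw [← ENNReal.ofReal_add (by positivity) (by positivity)]
  refine ENNReal.ofReal_le_ofReal ?_
  calc w x * ‖(f + g) x‖ * ‖v x‖ ≤ w x * (‖f x‖ + ‖g x‖) * ‖v x‖ := by
        gcongr; exact norm_add_le _ _
    _ = _ := by ring

theorem orliczNorm_smul (c : ℂ) (f : K → ℂ) :
    orliczNorm lam Φ w (c • f) = ENNReal.ofReal ‖c‖ * orliczNorm lam Φ w f := by
  unfold orliczNorm
  simp only [ENNReal.mul_iSup]
  refine iSup_congr fun v => iSup_congr fun hv => iSup_congr fun hv' => ?_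
  rw [← lintegral_const_mul' _ _ ENNReal.ofReal_ne_top]
  refine lintegral_congr fun x => ?_
  rw [← ENNReal.ofReal_mul (norm_nonneg _), Pi.smul_apply, norm_smul]
  ring_nf

instance : Norm (weightedOrlicz lam Φ w) :=
  ⟨fun f => (orliczNorm lam Φ w (f : K →ₘ[lam] ℂ)).toReal⟩

theorem weightedOrlicz_norm_def (f : weightedOrlicz lam Φ w) :
    ‖f‖ = (orliczNorm lam Φ w (f : K →ₘ[lam] ℂ)).toReal := rfl

theorem weightedOrlicz_core : SeminormedSpace.Core ℂ (weightedOrlicz lam Φ w) where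
  norm_nonneg f := ENNReal.toReal_nonneg
  norm_smul c f := by
    simp only [weightedOrlicz_norm_def, Submodule.coe_smul]
    rw [orliczNorm_congr (AEEqFun.coeFn_smul c (f : K →ₘ[lam] ℂ)), orliczNorm_smul]
    simp
  norm_triangle f g := by
    simp only [weightedOrlicz_norm_def, Submodule.coe_add]
    rw [← ENNReal.toReal_add (orliczNorm_ne_top f) (orliczNorm_ne_top g)]
    refine ENNReal.toReal_mono
      (ENNReal.add_ne_top.2 ⟨orliczNorm_ne_top f, orliczNorm_ne_top g⟩) ?_
    rw [orliczNorm_congr (AEEqFun.coeFn_add _ _)]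
    exact orliczNorm_add_le (f : K →ₘ[lam] ℂ).aestronglyMeasurable

instance : SeminormedAddCommGroup (weightedOrlicz lam Φ w) :=
  SeminormedAddCommGroup.ofCore weightedOrlicz_core

instance : NormedSpace ℂ (weightedOrlicz lam Φ w) where
  norm_smul_le c f := (weightedOrlicz_core.norm_smul c f).le

/-! ### Convolution operators -/

/-- `T` is the operator `f ↦ f * g` from `L^1_w(K)` to `L^Φ_w(K)`, where
`(f * g)(x) = ∫ f(y) g(y⁻ * x) dlam(y)`; these integrals converge absolutely. -/
def IsFunctionConvolution (g : K → ℂ)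
    (T : WeightedL1 lam w →L[ℂ] weightedOrlicz lam Φ w) : Prop :=
  ∀ f : WeightedL1 lam w, ∀ᵐ x ∂lam,
    Integrable (fun y => f y * evalConv g (inv y) x) lam ∧
    (T f : K →ₘ[lam] ℂ) x = ∫ y, f y * evalConv g (inv y) x ∂lam

/-- `T` is the operator `μ ↦ μ * g` from `M_w(K)` to `L^Φ_w(K)`, where
`(μ * g)(x) = ∫ g(y⁻ * x) dμ(y)`; these integrals converge absolutely. -/
def IsMeasureConvolution (g : K → ℂ)
    (T : weightedMeasures w →L[ℂ] weightedOrlicz lam Φ w) : Prop :=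
  ∀ μ : weightedMeasures w, ∀ᵐ x ∂lam,
    (μ : ComplexMeasure K).Integrable (fun y => evalConv g (inv y) x) ∧
    (T μ : K →ₘ[lam] ℂ) x =
      (μ : ComplexMeasure K).integral (fun y => evalConv g (inv y) x) (ContinuousLinearMap.mul ℝ ℂ)

end Hypergroup

end

/-!
The two convolution operators share their image up to closure: each element of the unit ball of one
of the spaces `L^1_w(K)` and `M_w(K)` is a limit of elements of a fixed ball of the other, in such a
way that the convolutions with `g` converge pointwise.

* A function `f` in `L^1_w(K)` is truncated to `f 1_{B n}`, where `f` is bounded on `B n` and `B n`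
  is contained in a compact set. The measures `f 1_{B n} lam` belong to `M_w(K)`, with norms at most
  `‖f‖`, and their convolutions with `g` tend to `f * g` by dominated convergence
  (`exists_functionConvolution_of_measureConvolution`).
* A measure `μ` in `M_w(K)` is first restricted to a compact set, which is then cut into small
  pieces `A`; the mass `μ(A)` is spread uniformly over a small open set near `A`. This requires
  nonempty open sets to have positive `lam`-measure, which follows from left invariance if
  `lam ≠ 0`. Since `w` is nearly constant and `y ↦ g(y⁻ * ·)` nearly uniformly constant near `A`,
  the resulting function has `L^1_w`-norm at most `2 ‖μ‖_w`, and its convolution with `g` is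
  uniformly close to that of the restricted measure (`exists_isSmearing`,
  `exists_measureConvolution_of_functionConvolution`).

Suppose now that one of the operators is compact. The approximations are mapped into a fixed compact
set of `L^Φ_w(K)`, and a subsequence of their images converges in norm. By Fatou's lemma the norm
limit and the pointwise limit differ by a function of Orlicz norm zero, so that the pointwise limit
is in the closure of the compact set (`exists_mem_closure_of_tendsto`). The other operator therefore
maps the unit ball into a compact set, so it exists as a map into `L^Φ_w(K)` and is compact
(`exists_compact_operator`). A subtlety is that `lam` need not be `σ`-finite, so that the Orlicz norm
does not see functions living on a locally null set. The convolutions in question vanish off a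
`σ`-compact set, and on sets of finite measure the norm does determine a function.

The topological input consists of facts about supports: `x * y` depends continuously on `(x, y)`, and
`t ∈ y⁻ * x` implies both `x ∈ y * t` and `y ∈ x * t⁻`, so that `x ↦ g(y⁻ * x)` and `y ↦ g(y⁻ * x)`
have compact support. These implications come from associativity of the convolution of three point
masses, once it is known that the convolution of two measures is determined by its values at point
masses (`PosRadon.eq_integral_dirac`).
-/

/-! ### Nonnegative complex measures and the cone topology -/

namespace IsNonnegMeasure

variable {K : Type*} [MeasurableSpace K] {μ ν : ComplexMeasure K}

theorem enorm_apply (hμ : IsNonnegMeasure μ) (E : Set K) :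
    ‖μ E‖ₑ = ENNReal.ofReal (μ E).re := by
  have h : μ E = ((μ E).re : ℂ) := by
    apply Complex.ext <;> simp [(hμ E).2]
  rw [← ofReal_norm, h, Complex.norm_real, Complex.ofReal_re, Real.norm_eq_abs,
    abs_of_nonneg (hμ E).1]

/-- A nonnegative complex measure equals its total variation. -/
theorem variation_apply (hμ : IsNonnegMeasure μ) {E : Set K} (hE : MeasurableSet E) :
    μ.variation E = ENNReal.ofReal (μ E).re := by
  refine le_antisymm (le_of_forall_lt fun a ha => ?_) ?_
  · obtain ⟨P, hPE, hPd, hPm, haP⟩ := VectorMeasure.exists_lt_sum_of_lt_variation μ hE ha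
    refine haP.trans_le ?_
    simp_rw [hμ.enorm_apply]
    rw [← ENNReal.ofReal_sum_of_nonneg fun p _ => (hμ p).1]
    have hU : MeasurableSet (⋃ p ∈ P, p) := P.measurableSet_biUnion hPm
    have h1 : μ (⋃ p ∈ P, p) = ∑ p ∈ P, μ p := μ.of_biUnion_finset hPd hPm
    have h2 : μ E = μ (⋃ p ∈ P, p) + μ (E \ ⋃ p ∈ P, p) := by
      rw [← VectorMeasure.of_union disjoint_sdiff_right hU (hE.diff hU), union_sdiff_cancel]
      exact iUnion₂_subset hPE
    refine ENNReal.ofReal_le_ofReal ?_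
    rw [h2, h1, Complex.add_re, Complex.re_sum]
    linarith [(hμ (E \ ⋃ p ∈ P, p)).1]
  · rw [← hμ.enorm_apply]
    exact VectorMeasure.enorm_measure_le_variation μ E

theorem smul (hμ : IsNonnegMeasure μ) {a : ℝ} (ha : 0 ≤ a) : IsNonnegMeasure ((a : ℂ) • μ) := by
  intro E
  have h := hμ E
  simp only [smul_apply, smul_eq_mul, Complex.re_ofReal_mul, Complex.im_ofReal_mul,
    h.2, mul_zero, and_true]
  exact mul_nonneg ha h.1

theorem add (hμ : IsNonnegMeasure μ) (hν : IsNonnegMeasure ν) : IsNonnegMeasure (μ + ν) := by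
  intro E
  simp [(hμ E).2, (hν E).2, add_nonneg (hμ E).1 (hν E).1]

theorem variation_add (hμ : IsNonnegMeasure μ) (hν : IsNonnegMeasure ν) :
    (μ + ν).variation = μ.variation + ν.variation := by
  ext E hE
  rw [(hμ.add hν).variation_apply hE, Measure.add_apply, hμ.variation_apply hE,
    hν.variation_apply hE, ← ENNReal.ofReal_add (hμ E).1 (hν E).1]
  simp

end IsNonnegMeasure

theorem PosRadon.exists_bound_test {K : Type*} [TopologicalSpace K]
    (f : {f : C(K, ℝ) // (HasCompactSupport f ∧ ∀ x, 0 ≤ f x) ∨ f = 1}) :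
    ∃ C, ∀ x, |f.1 x| ≤ C := by
  obtain ⟨f, hf | rfl⟩ := f
  · exact f.continuous.bounded_above_of_compact_support hf.1
  · exact ⟨1, fun x => by simp⟩

namespace PosRadon

variable {K : Type*} [TopologicalSpace K] [T2Space K] [MeasurableSpace K] [BorelSpace K]

instance (ρ : PosRadon K) : IsFiniteMeasure (ρ.1 : ComplexMeasure K).variation := ρ.1.2.1

instance (ρ : PosRadon K) : (ρ.1 : ComplexMeasure K).variation.Regular := ρ.1.2.2

/-- The point mass at `x` as an element of `M⁺(K)`. -/
noncomputable def dirac (x : K) : PosRadon K :=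
  ⟨diracRadon x, by
    intro E
    by_cases hE : MeasurableSet E
    · by_cases hx : x ∈ E <;> simp [diracRadon, VectorMeasure.dirac, hE, hx]
    · simp [VectorMeasure.not_measurable _ hE]⟩

@[simp]
theorem variation_dirac (x : K) :
    ((dirac x).1 : ComplexMeasure K).variation = Measure.dirac x := by
  simp [dirac, diracRadon]

theorem continuous_dirac : Continuous (dirac : K → PosRadon K) := by
  refine continuous_induced_rng.2 (continuous_pi fun f => ?_)
  have : (fun x : K => ∫ t, f.1 t ∂((dirac x).1 : ComplexMeasure K).variation) = f.1 := by
    ext x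
    rw [variation_dirac, integral_dirac' _ _ f.1.continuous.stronglyMeasurable]
  change Continuous (fun x : K => ∫ t, f.1 t ∂((dirac x).1 : ComplexMeasure K).variation)
  rw [this]
  exact f.1.continuous

theorem continuous_integral {f : K → ℝ} (hf : Continuous f) (hfc : HasCompactSupport f)
    (hf0 : ∀ x, 0 ≤ f x) :
    Continuous fun ρ : PosRadon K => ∫ t, f t ∂(ρ.1 : ComplexMeasure K).variation := by
  have h : Continuous (fun (ρ : PosRadon K)
      (f : {f : C(K, ℝ) // (HasCompactSupport f ∧ ∀ x, 0 ≤ f x) ∨ f = 1}) =>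
      ∫ x, f.1 x ∂(ρ.1 : ComplexMeasure K).variation) := continuous_induced_dom
  exact continuous_pi_iff.1 h ⟨⟨f, hf⟩, Or.inl ⟨hfc, hf0⟩⟩

/-- The convex combination `a ρ + b σ` in `M⁺(K)`. -/
noncomputable def combo (a b : ℝ) (ha : 0 ≤ a) (hb : 0 ≤ b) (ρ σ : PosRadon K) : PosRadon K :=
  ⟨(a : ℂ) • ρ.1 + (b : ℂ) • σ.1, (ρ.2.smul ha).add (σ.2.smul hb)⟩

theorem integral_combo {a b : ℝ} (ha : 0 ≤ a) (hb : 0 ≤ b) (ρ σ : PosRadon K) {f : K → ℝ}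
    (hρ : Integrable f (ρ.1 : ComplexMeasure K).variation)
    (hσ : Integrable f (σ.1 : ComplexMeasure K).variation) :
    ∫ x, f x ∂((combo a b ha hb ρ σ).1 : ComplexMeasure K).variation =
      a * ∫ x, f x ∂(ρ.1 : ComplexMeasure K).variation +
        b * ∫ x, f x ∂(σ.1 : ComplexMeasure K).variation := by
  have h : ((combo a b ha hb ρ σ).1 : ComplexMeasure K).variation =
      ‖(a : ℂ)‖₊ • (ρ.1 : ComplexMeasure K).variation +
        ‖(b : ℂ)‖₊ • (σ.1 : ComplexMeasure K).variation := by
    change ((a : ℂ) • (ρ.1 : ComplexMeasure K) + (b : ℂ) • (σ.1 : ComplexMeasure K)).variation = _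
    rw [(ρ.2.smul ha).variation_add (σ.2.smul hb), VectorMeasure.variation_smul,
      VectorMeasure.variation_smul]
  rw [h, integral_add_measure (hρ.smul_measure_nnreal) (hσ.smul_measure_nnreal),
    integral_smul_nnreal_measure, integral_smul_nnreal_measure]
  simp [NNReal.smul_def, abs_of_nonneg ha, abs_of_nonneg hb]

theorem integrable_of_bounded (ρ : PosRadon K) {f : K → ℝ} (hf : Continuous f) {C : ℝ}
    (hC : ∀ x, |f x| ≤ C) : Integrable f (ρ.1 : ComplexMeasure K).variation :=
  Integrable.of_bound hf.aestronglyMeasurable C (Eventually.of_forall hC)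

/-- A continuous affine functional on `M⁺(K)` is given on probability measures by integrating its
values at the point masses: finitely many test functions see a probability measure as a point of
the closed convex hull of the image of `K`, so it is a limit of convex combinations of point
masses. -/
theorem eq_integral_dirac {Λ : PosRadon K → ℝ} (hΛ : Continuous Λ)
    (haff : ∀ a b ha hb ρ σ, a + b = 1 → Λ (combo a b ha hb ρ σ) = a * Λ ρ + b * Λ σ)
    {C : ℝ} (hC : ∀ x, |Λ (dirac x)| ≤ C) (ν : PosRadon K)
    [hν : IsProbabilityMeasure (ν.1 : ComplexMeasure K).variation] :
    Λ ν = ∫ x, Λ (dirac x) ∂(ν.1 : ComplexMeasure K).variation := by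
  have hψ : Continuous fun x : K => Λ (dirac x) := hΛ.comp continuous_dirac
  refine eq_of_forall_dist_le fun ε hε => ?_
  have hnear : ∀ᶠ ρ in 𝓝 ν, dist (Λ ρ) (Λ ν) < ε / 2 := hΛ.continuousAt.eventually
    (Metric.ball_mem_nhds _ (half_pos hε))
  rw [nhds_induced, eventually_comap] at hnear
  -- Only finitely many test functions matter for the accuracy `ε / 2`.
  rw [Filter.Eventually, nhds_pi, Filter.mem_pi] at hnear
  obtain ⟨J, hJ, t, ht, hJt⟩ := hnear
  have : Fintype J := hJ.fintype
  -- The coordinate `none` records the values of `Λ` at the point masses.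
  let F : Option J → K → ℝ := fun o x => o.elim (Λ (dirac x)) (fun j => j.1.1 x)
  have hFc : ∀ o, Continuous (F o) := by
    rintro (_ | j)
    · exact hψ
    · exact j.1.1.continuous
  have hFb : ∀ o, ∃ C, ∀ x, |F o x| ≤ C := by
    rintro (_ | j)
    · exact ⟨C, hC⟩
    · exact exists_bound_test j.1
  have hFi : ∀ o (ρ : PosRadon K), Integrable (F o) (ρ.1 : ComplexMeasure K).variation :=
    fun o ρ => let ⟨_, h⟩ := hFb o; ρ.integrable_of_bounded (hFc o) h
  let I : PosRadon K → Option J → ℝ := fun ρ o => ∫ x, F o x ∂(ρ.1 : ComplexMeasure K).variation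
  let A : Set (Option J → ℝ) := I '' {ρ | Λ ρ = I ρ none}
  have hA : Convex ℝ A := by
    rintro _ ⟨ρ, hρ, rfl⟩ _ ⟨σ, hσ, rfl⟩ a b ha hb hab
    have hI : I (combo a b ha hb ρ σ) = a • I ρ + b • I σ := by
      ext o
      simpa [I] using integral_combo ha hb ρ σ (hFi o ρ) (hFi o σ)
    refine ⟨combo a b ha hb ρ σ, ?_, hI⟩
    simp only [mem_ofPred_eq] at hρ hσ ⊢
    rw [hI, haff _ _ _ _ _ _ hab, hρ, hσ]
    rfl
  have hD : ∀ x, (fun o => F o x) ∈ A := fun x => by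
    have hI : I (dirac x) = fun o => F o x := by
      ext o
      simp only [I]
      rw [variation_dirac, integral_dirac' _ _ (hFc o).stronglyMeasurable]
    exact ⟨dirac x, by simp only [mem_ofPred_eq]; rw [hI]; rfl, hI⟩
  have hmem : I ν ∈ closure A := by
    have h1 := hA.closure.integral_mem (μ := (ν.1 : ComplexMeasure K).variation) isClosed_closure
      (f := fun x o => F o x) (Eventually.of_forall fun x => subset_closure (hD x))
      (Integrable.of_eval fun o => hFi o ν)
    have h2 : I ν = ∫ x, (fun o => F o x) ∂(ν.1 : ComplexMeasure K).variation := by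
      ext o
      rw [eval_integral fun o => hFi o ν]
    rwa [h2]
  have hN : {z : Option J → ℝ | (∀ j : J, z (some j) ∈ t j) ∧ dist (z none) (I ν none) < ε / 2} ∈
      𝓝 (I ν) := by
    refine Filter.inter_mem ?_ ?_
    · refine (eventually_all).2 fun j => ?_
      exact (continuous_apply (some j)).continuousAt.eventually (ht j.1)
    · exact (continuous_apply (none : Option J)).continuousAt.preimage_mem_nhds
        (Metric.ball_mem_nhds (I ν none) (half_pos hε))
  obtain ⟨_, ⟨hz1, hz2⟩, ρ, hρ, rfl⟩ := mem_closure_iff_nhds.1 hmem _ hN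
  have h1 : dist (Λ ρ) (Λ ν) < ε / 2 := hJt (fun j hj => hz1 ⟨j, hj⟩) ρ rfl
  have h2 : dist (Λ ρ) (I ν none) < ε / 2 := by
    rw [show Λ ρ = I ρ none from hρ]; exact hz2
  have h3 : dist (Λ ν) (I ν none) ≤ ε := by
    have := dist_triangle_left (Λ ν) (I ν none) (Λ ρ)
    linarith
  exact h3

end PosRadon

/-! ### Supports of convolutions of point masses -/

/-- A nonnegative continuous function that is positive at a point of the support of a measure has
positive integral. -/
theorem integral_pos_of_mem_support {K : Type*} [TopologicalSpace K]
    [MeasurableSpace K] {μ : Measure K} {f : K → ℝ} (hf : Continuous f)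
    (hfi : Integrable f μ) (hf0 : ∀ x, 0 ≤ f x) {t : K} (ht : t ∈ μ.support) (hft : 0 < f t) :
    0 < ∫ x, f x ∂μ := by
  rw [integral_pos_iff_support_of_nonneg hf0 hfi]
  exact (Measure.mem_support_iff_forall t).1 ht _
    (hf.isOpen_support.mem_nhds hft.ne')

/-- Urysohn: a point lies in a closed set as soon as no test function that is positive at the point
vanishes on the set. -/
theorem mem_of_forall_exists_apply_ne_zero {K : Type*} [TopologicalSpace K] [T2Space K]
    [LocallyCompactSpace K] {C : Set K} (hC : IsClosed C) {u : K}
    (h : ∀ f : K → ℝ, Continuous f → HasCompactSupport f → (∀ x, 0 ≤ f x) → 0 < f u →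
      ∃ x ∈ C, f x ≠ 0) : u ∈ C := by
  by_contra hu
  obtain ⟨f, hf1, hf0, hfc, hf⟩ := exists_continuous_one_zero_of_isCompact
    (isCompact_singleton (x := u)) hC (disjoint_singleton_left.2 hu)
  obtain ⟨x, hx, hfx⟩ := h f f.continuous hfc (fun x => (hf x).1)
    (by rw [hf1 rfl]; exact one_pos)
  exact hfx (hf0 hx)

namespace Hypergroup

variable {K : Type*} [TopologicalSpace K] [T2Space K] [LocallyCompactSpace K]
  [MeasurableSpace K] [BorelSpace K] [Hypergroup K]

/-- The convolution of `M⁺(K)`. -/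
noncomputable def posConv (ρ σ : PosRadon K) : PosRadon K :=
  ⟨conv ρ.1 σ.1, conv_nonneg ρ.1 σ.1 ρ.2 σ.2⟩

theorem continuous_posConv : Continuous fun p : PosRadon K × PosRadon K => posConv p.1 p.2 :=
  continuous_conv

instance (x y : K) : IsProbabilityMeasure (pointConv x y) := dirac_conv_prob x y

instance (x y : K) : (pointConv x y).Regular := (conv (diracRadon x) (diracRadon y)).2.2

theorem variation_posConv_dirac (x y : K) :
    ((posConv (PosRadon.dirac x) (PosRadon.dirac y)).1 : ComplexMeasure K).variation =
      pointConv x y := rfl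

instance (x y : K) : IsProbabilityMeasure
    ((posConv (PosRadon.dirac x) (PosRadon.dirac y)).1 : ComplexMeasure K).variation :=
  dirac_conv_prob x y

theorem integral_posConv_dirac (f : K → ℝ) (x y : K) :
    ∫ t, f t ∂((posConv (PosRadon.dirac x) (PosRadon.dirac y)).1 : ComplexMeasure K).variation =
      evalConv f x y := rfl

theorem continuous_evalConv_of_nonneg {f : K → ℝ} (hf : Continuous f) (hfc : HasCompactSupport f)
    (hf0 : ∀ x, 0 ≤ f x) : Continuous fun p : K × K => evalConv f p.1 p.2 := by
  have h : Continuous fun p : K × K => posConv (PosRadon.dirac p.1) (PosRadon.dirac p.2) :=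
    continuous_posConv.comp ((PosRadon.continuous_dirac.comp continuous_fst).prodMk
      (PosRadon.continuous_dirac.comp continuous_snd))
  simp_rw [← integral_posConv_dirac]
  exact (PosRadon.continuous_integral hf hfc hf0).comp h

theorem norm_evalConv_le {E : Type*} [NormedAddCommGroup E] [NormedSpace ℝ E] {f : K → E} {C : ℝ}
    (hC : ∀ x, ‖f x‖ ≤ C) (x y : K) : ‖evalConv f x y‖ ≤ C := by
  have h := norm_integral_le_of_norm_le_const (μ := pointConv x y) (Eventually.of_forall hC)
  rw [probReal_univ, mul_one] at h
  exact h

theorem evalConv_nonneg {f : K → ℝ} (hf : ∀ x, 0 ≤ f x) (x y : K) : 0 ≤ evalConv f x y :=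
  integral_nonneg hf

theorem integrable_pointConv {E : Type*} [NormedAddCommGroup E] {f : K → E} (hf : Continuous f)
    (hfc : HasCompactSupport f) (x y : K) : Integrable f (pointConv x y) :=
  hf.integrable_of_hasCompactSupport hfc

section Fubini

variable {f : K → ℝ}

theorem integral_posConv_combo_left (hf : Continuous f) (hfc : HasCompactSupport f) (a b : ℝ)
    (ha : 0 ≤ a) (hb : 0 ≤ b) (ρ σ τ : PosRadon K) :
    ∫ t, f t ∂((posConv (PosRadon.combo a b ha hb ρ σ) τ).1 : ComplexMeasure K).variation =
      a * ∫ t, f t ∂((posConv ρ τ).1 : ComplexMeasure K).variation +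
        b * ∫ t, f t ∂((posConv σ τ).1 : ComplexMeasure K).variation := by
  have h : posConv (PosRadon.combo a b ha hb ρ σ) τ =
      PosRadon.combo a b ha hb (posConv ρ τ) (posConv σ τ) :=
    Subtype.ext (by simp [posConv, PosRadon.combo])
  rw [h]
  exact PosRadon.integral_combo ha hb _ _ (hf.integrable_of_hasCompactSupport hfc)
    (hf.integrable_of_hasCompactSupport hfc)

theorem integral_posConv_combo_right (hf : Continuous f) (hfc : HasCompactSupport f) (a b : ℝ)
    (ha : 0 ≤ a) (hb : 0 ≤ b) (ρ σ τ : PosRadon K) :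
    ∫ t, f t ∂((posConv τ (PosRadon.combo a b ha hb ρ σ)).1 : ComplexMeasure K).variation =
      a * ∫ t, f t ∂((posConv τ ρ).1 : ComplexMeasure K).variation +
        b * ∫ t, f t ∂((posConv τ σ).1 : ComplexMeasure K).variation := by
  have h : posConv τ (PosRadon.combo a b ha hb ρ σ) =
      PosRadon.combo a b ha hb (posConv τ ρ) (posConv τ σ) :=
    Subtype.ext (by simp [posConv, PosRadon.combo])
  rw [h]
  exact PosRadon.integral_combo ha hb _ _ (hf.integrable_of_hasCompactSupport hfc)
    (hf.integrable_of_hasCompactSupport hfc)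

/-- Associativity of `δ_a * δ_b * δ_c`, tested on a function. -/
theorem integral_evalConv_assoc (hf : Continuous f) (hfc : HasCompactSupport f)
    (hf0 : ∀ x, 0 ≤ f x) (a b c : K) :
    ∫ s, evalConv f s c ∂(pointConv a b) = ∫ s, evalConv f a s ∂(pointConv b c) := by
  obtain ⟨C, hC⟩ := hf.bounded_above_of_compact_support hfc
  have h1 := PosRadon.eq_integral_dirac (Λ := fun ρ => ∫ t, f t
      ∂((posConv ρ (PosRadon.dirac c)).1 : ComplexMeasure K).variation)
    ((PosRadon.continuous_integral hf hfc hf0).comp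
      (continuous_posConv.comp (continuous_id.prodMk continuous_const)))
    (fun u v hu hv ρ σ _ => integral_posConv_combo_left hf hfc u v hu hv ρ σ _)
    (fun x => norm_evalConv_le hC x c) (posConv (PosRadon.dirac a) (PosRadon.dirac b))
  have h2 := PosRadon.eq_integral_dirac (Λ := fun ρ => ∫ t, f t
      ∂((posConv (PosRadon.dirac a) ρ).1 : ComplexMeasure K).variation)
    ((PosRadon.continuous_integral hf hfc hf0).comp
      (continuous_posConv.comp (continuous_const.prodMk continuous_id)))
    (fun u v hu hv ρ σ _ => integral_posConv_combo_right hf hfc u v hu hv ρ σ _)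
    (fun x => norm_evalConv_le hC a x) (posConv (PosRadon.dirac b) (PosRadon.dirac c))
  have h3 : posConv (posConv (PosRadon.dirac a) (PosRadon.dirac b)) (PosRadon.dirac c) =
      posConv (PosRadon.dirac a) (posConv (PosRadon.dirac b) (PosRadon.dirac c)) :=
    Subtype.ext (conv_assoc _ _ _)
  simp only [variation_posConv_dirac, h3] at h1 h2
  exact h1.symm.trans h2

end Fubini

theorem evalConv_eq_zero {E : Type*} [NormedAddCommGroup E] [NormedSpace ℝ E] {f : K → E} {x y : K}
    (h : ∀ t ∈ (pointConv x y).support, f t = 0) : evalConv f x y = 0 :=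
  integral_eq_zero_of_ae (by filter_upwards [Measure.support_mem_ae_of_regular] with t ht using h t ht)

theorem evalConv_pos {f : K → ℝ} (hf : Continuous f) (hfc : HasCompactSupport f)
    (hf0 : ∀ x, 0 ≤ f x) {x y t : K} (ht : t ∈ (pointConv x y).support) (hft : 0 < f t) :
    0 < evalConv f x y :=
  integral_pos_of_mem_support hf (integrable_pointConv hf hfc x y) hf0 ht hft

/-- For compact `A` and `B` the set `A * B` is compact. -/
theorem isCompact_biUnion_support {A B : Set K} (hA : IsCompact A) (hB : IsCompact B) :
    IsCompact (⋃ p ∈ A ×ˢ B, (pointConv p.1 p.2).support) := by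
  obtain ⟨S, hS, hSs⟩ := continuous_support (K := K)
  have h := TopologicalSpace.Compacts.isCompact_biUnion_coe_of_isCompact
    ((hA.prod hB).image (TopologicalSpace.NonemptyCompacts.continuous_toCompacts.comp hS))
  rw [biUnion_image] at h
  convert! h using 4 with p hp
  exact (hSs p.1 p.2).symm

theorem isCompact_support_pointConv (x y : K) : IsCompact (pointConv x y).support := by
  obtain ⟨S, -, hSs⟩ := continuous_support (K := K)
  exact (hSs x y) ▸ (S (x, y)).isCompact

/-- The inclusion `a * (b * c) ⊆ (a * b) * c` of sets of support points. -/
theorem mem_support_assoc_left {a b c s u : K} (hs : s ∈ (pointConv b c).support)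
    (hu : u ∈ (pointConv a s).support) :
    ∃ t ∈ (pointConv a b).support, u ∈ (pointConv t c).support := by
  have hC := isCompact_biUnion_support (isCompact_support_pointConv a b)
    (isCompact_singleton (x := c))
  have huC : u ∈ ⋃ p ∈ (pointConv a b).support ×ˢ {c}, (pointConv p.1 p.2).support := by
    refine mem_of_forall_exists_apply_ne_zero hC.isClosed fun f hf hfc hf0 hfu => ?_
    by_contra! hne
    obtain ⟨M, hM⟩ := hf.bounded_above_of_compact_support hfc
    have hpair : Continuous fun t : K => (a, t) := Continuous.prodMk_right a
    have hcont := (continuous_evalConv_of_nonneg hf hfc hf0).comp hpair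
    simp only [Function.comp_def] at hcont
    have hint : Integrable (fun t => evalConv f a t) (pointConv b c) :=
      Integrable.of_bound hcont.aestronglyMeasurable M
        (Eventually.of_forall fun t => norm_evalConv_le hM a t)
    have h1 : 0 < ∫ t, evalConv f a t ∂(pointConv b c) :=
      integral_pos_of_mem_support hcont hint (fun t => evalConv_nonneg hf0 _ _) hs
        (evalConv_pos hf hfc hf0 hu hfu)
    rw [← integral_evalConv_assoc hf hfc hf0] at h1
    refine h1.ne' (integral_eq_zero_of_ae ?_)
    filter_upwards [Measure.support_mem_ae_of_regular] with t ht
    refine evalConv_eq_zero fun r hr => hne r ?_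
    exact mem_biUnion (x := (t, c)) ⟨ht, rfl⟩ hr
  obtain ⟨⟨t, c'⟩, ⟨ht, rfl⟩, hut⟩ := mem_iUnion₂.1 huC
  exact ⟨t, ht, hut⟩

/-- The inclusion `(a * b) * c ⊆ a * (b * c)` of sets of support points. -/
theorem mem_support_assoc_right {a b c s u : K} (hs : s ∈ (pointConv a b).support)
    (hu : u ∈ (pointConv s c).support) :
    ∃ t ∈ (pointConv b c).support, u ∈ (pointConv a t).support := by
  have hC := isCompact_biUnion_support (isCompact_singleton (x := a))
    (isCompact_support_pointConv b c)
  have huC : u ∈ ⋃ p ∈ {a} ×ˢ (pointConv b c).support, (pointConv p.1 p.2).support := by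
    refine mem_of_forall_exists_apply_ne_zero hC.isClosed fun f hf hfc hf0 hfu => ?_
    by_contra! hne
    obtain ⟨M, hM⟩ := hf.bounded_above_of_compact_support hfc
    have hpair : Continuous fun t : K => (t, c) := Continuous.prodMk_left c
    have hcont := (continuous_evalConv_of_nonneg hf hfc hf0).comp hpair
    simp only [Function.comp_def] at hcont
    have hint : Integrable (fun t => evalConv f t c) (pointConv a b) :=
      Integrable.of_bound hcont.aestronglyMeasurable M
        (Eventually.of_forall fun t => norm_evalConv_le hM t c)
    have h1 : 0 < ∫ t, evalConv f t c ∂(pointConv a b) :=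
      integral_pos_of_mem_support hcont hint (fun t => evalConv_nonneg hf0 _ _) hs
        (evalConv_pos hf hfc hf0 hu hfu)
    rw [integral_evalConv_assoc hf hfc hf0] at h1
    refine h1.ne' (integral_eq_zero_of_ae ?_)
    filter_upwards [Measure.support_mem_ae_of_regular] with t ht
    refine evalConv_eq_zero fun r hr => hne r ?_
    exact mem_biUnion (x := (a, t)) ⟨rfl, ht⟩ hr
  obtain ⟨⟨a', t⟩, ⟨rfl, ht⟩, hut⟩ := mem_iUnion₂.1 huC
  exact ⟨t, ht, hut⟩

theorem one_mem_support_pointConv {x y : K} : one ∈ (pointConv x y).support ↔ x = inv y :=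
  one_mem_support_iff x y

/-- If `t ∈ x * y` then `t⁻ ∈ y⁻ * x⁻`. -/
theorem inv_mem_support {x y t : K} (ht : t ∈ (pointConv x y).support) :
    inv t ∈ (pointConv (inv y) (inv x)).support := by
  rw [Measure.mem_support_iff_forall] at ht ⊢
  intro U hU
  obtain ⟨V, hVU, hV, htV⟩ := mem_nhds_iff.1 hU
  refine lt_of_lt_of_le ?_ (measure_mono hVU)
  have himage : inv '' V = inv ⁻¹' V := by
    rw [image_eq_preimage_of_inverse] <;> intro <;> simp [inv_inv]
  have hpre : IsOpen (inv '' V) := himage ▸ hV.preimage continuous_inv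
  have h := ht _ (hpre.mem_nhds (by rw [himage]; exact htV))
  have e1 := (posConv (PosRadon.dirac x) (PosRadon.dirac y)).2.variation_apply hpre.measurableSet
  have e2 := (posConv (PosRadon.dirac (inv y)) (PosRadon.dirac (inv x))).2.variation_apply
    hV.measurableSet
  have e3 := dirac_conv_inv x y V hV.measurableSet
  rw [variation_posConv_dirac] at e1 e2
  rw [e2]
  rw [e1] at h
  refine h.trans_eq ?_
  congr 2

/-- If `t ∈ y⁻ * x` then `x ∈ y * t`. -/
theorem mem_support_pointConv_of_inv_left {x y t : K} (h : t ∈ (pointConv (inv y) x).support) :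
    x ∈ (pointConv y t).support := by
  obtain ⟨s, hs, h1⟩ := mem_support_assoc_left (a := inv t) h
    (one_mem_support_pointConv.2 rfl)
  rw [one_mem_support_pointConv.1 h1] at hs
  simpa only [inv_inv] using inv_mem_support hs

/-- If `t ∈ y⁻ * x` then `y ∈ x * t⁻`. -/
theorem mem_support_pointConv_inv_right {x y t : K} (h : t ∈ (pointConv (inv y) x).support) :
    y ∈ (pointConv x (inv t)).support := by
  obtain ⟨s, hs, h1⟩ := mem_support_assoc_right (c := inv t) h
    (one_mem_support_pointConv.2 (inv_inv t).symm)
  have h2 := congrArg inv (one_mem_support_pointConv.1 h1)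
  rw [inv_inv, inv_inv] at h2
  rwa [h2]

/-- Some left translate of `y` reaches `x`, because `x ∈ x * e ⊆ (x * y⁻) * y`. -/
theorem exists_mem_support_pointConv (x y : K) : ∃ s, x ∈ (pointConv s y).support := by
  have h : x ∈ (pointConv x one).support := by
    have : pointConv x one = Measure.dirac x := by
      rw [← PosRadon.variation_dirac, pointConv, conv_one]
      rfl
    rw [this, Measure.mem_support_iff_forall]
    intro U hU
    obtain ⟨V, hVU, hV, hxV⟩ := mem_nhds_iff.1 hU
    refine lt_of_lt_of_le ?_ (measure_mono hVU)
    simp [Measure.dirac_apply' x hV.measurableSet, hxV]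
  obtain ⟨s, -, hs⟩ := mem_support_assoc_left (b := inv y) (c := y)
    (one_mem_support_pointConv.2 rfl) h
  exact ⟨s, hs⟩

/-- `(x, y) ↦ g(x * y)` is continuous for `g ∈ C_c(K)`. -/
theorem continuous_evalConv {g : K → ℂ} (hg : Continuous g) (hgc : HasCompactSupport g) :
    Continuous fun p : K × K => evalConv g p.1 p.2 := by
  have hreal : ∀ f : K → ℝ, Continuous f → HasCompactSupport f →
      Continuous fun p : K × K => evalConv f p.1 p.2 := fun f hf hfc => by
    have hpos := continuous_evalConv_of_nonneg (f := fun x => max (f x) 0)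
      (hf.max continuous_const) (hfc.comp_left (g := fun r : ℝ => max r 0) (by simp))
      (fun x => le_max_right _ _)
    have hneg := continuous_evalConv_of_nonneg (f := fun x => max (-f x) 0)
      (hf.neg.max continuous_const) (hfc.comp_left (g := fun r : ℝ => max (-r) 0) (by simp))
      (fun x => le_max_right _ _)
    refine (hpos.sub hneg).congr fun p => Eq.symm ?_
    change evalConv f p.1 p.2 = evalConv _ p.1 p.2 - evalConv _ p.1 p.2
    unfold evalConv
    rw [← integral_sub]
    · refine integral_congr_ae (Eventually.of_forall fun t => ?_)
      exact (max_zero_sub_eq_self (f t)).symm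
    · exact integrable_pointConv (hf.max continuous_const)
        (hfc.comp_left (g := fun r : ℝ => max r 0) (by simp)) _ _
    · exact integrable_pointConv (hf.neg.max continuous_const)
        (hfc.comp_left (g := fun r : ℝ => max (-r) 0) (by simp)) _ _
  have hre := hreal (fun x => (g x).re) (Complex.continuous_re.comp hg)
    (hgc.comp_left (g := Complex.re) rfl)
  have him := hreal (fun x => (g x).im) (Complex.continuous_im.comp hg)
    (hgc.comp_left (g := Complex.im) rfl)
  have h := (Complex.continuous_ofReal.comp hre).add
    ((Complex.continuous_ofReal.comp him).mul (continuous_const (y := Complex.I)))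
  refine h.congr fun p => ?_
  have h1 := integral_re_add_im (𝕜 := ℂ) (integrable_pointConv hg hgc p.1 p.2)
  exact h1

theorem continuous_evalConv_inv {g : K → ℂ} (hg : Continuous g) (hgc : HasCompactSupport g) :
    Continuous fun p : K × K => evalConv g (inv p.1) p.2 := by
  have h := (continuous_evalConv hg hgc).comp
    ((continuous_inv.comp continuous_fst).prodMk continuous_snd : Continuous fun p : K × K =>
      (inv p.1, p.2))
  exact h

/-- For `y ∈ A` the translate `g(y⁻ * ·)` vanishes off the compact set `A * supp g`. -/
theorem evalConv_inv_eq_zero_of_notMem {g : K → ℂ} {A : Set K} {x y : K} (hy : y ∈ A)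
    (hx : x ∉ ⋃ p ∈ A ×ˢ tsupport g, (pointConv p.1 p.2).support) :
    evalConv g (inv y) x = 0 := by
  refine evalConv_eq_zero fun t ht => ?_
  by_contra hgt
  exact hx (mem_biUnion (x := (y, t)) ⟨hy, subset_tsupport g hgt⟩
    (mem_support_pointConv_of_inv_left ht))

/-- The function `y ↦ g(y⁻ * x)` is supported in `x * (supp g)⁻`. -/
theorem hasCompactSupport_evalConv_inv {g : K → ℂ} (hgc : HasCompactSupport g) (x : K) :
    HasCompactSupport fun y => evalConv g (inv y) x := by
  refine HasCompactSupport.intro (isCompact_biUnion_support (isCompact_singleton (x := x))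
    (hgc.isCompact.image continuous_inv)) fun y hy => evalConv_eq_zero fun t ht => ?_
  by_contra hgt
  exact hy (mem_biUnion (x := (x, inv t)) ⟨rfl, mem_image_of_mem _ (subset_tsupport g hgt)⟩
    (mem_support_pointConv_inv_right ht))

/-- A nonzero left-invariant measure has full support. -/
theorem IsLeftInvariant.isOpenPosMeasure {lam : Measure K} [lam.Regular]
    (hlam : IsLeftInvariant lam) (h0 : lam ≠ 0) : lam.IsOpenPosMeasure := by
  refine ⟨fun U hU ⟨x, hx⟩ hU0 => ?_⟩
  obtain ⟨f, hf1, hf0, hfc, hf⟩ := exists_continuous_one_zero_of_isCompact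
    (isCompact_singleton (x := x)) hU.isClosed_compl (disjoint_singleton_left.2 (by simpa using hx))
  obtain ⟨y, hy⟩ : lam.support.Nonempty := by
    by_contra h
    have h1 := Measure.measure_compl_support_of_regular (μ := lam)
    rw [not_nonempty_iff_eq_empty.1 h, compl_empty] at h1
    exact h0 (Measure.measure_univ_eq_zero.1 h1)
  obtain ⟨s, hs⟩ := exists_mem_support_pointConv x y
  have hfn : ∀ x, 0 ≤ f x := fun x => (hf x).1
  have hpair : Continuous fun t : K => (s, t) := Continuous.prodMk_right s
  have hcont := (continuous_evalConv_of_nonneg f.continuous hfc hfn).comp hpair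
  simp only [Function.comp_def] at hcont
  have hcs : HasCompactSupport fun t => evalConv f s t := by
    refine HasCompactSupport.intro (isCompact_biUnion_support (isCompact_singleton (x := inv s))
      hfc.isCompact) fun t ht => evalConv_eq_zero fun r hr => ?_
    by_contra hgt
    refine ht (mem_biUnion (x := (inv s, r)) ⟨rfl, subset_tsupport f hgt⟩ ?_)
    exact mem_support_pointConv_of_inv_left (by rwa [inv_inv])
  have h1 : 0 < ∫ t, evalConv f s t ∂lam :=
    integral_pos_of_mem_support hcont (hcont.integrable_of_hasCompactSupport hcs)
      (fun t => evalConv_nonneg hfn _ _) hy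
      (evalConv_pos f.continuous hfc hfn hs (by rw [hf1 rfl]; exact one_pos))
  rw [hlam s f f.continuous hfc] at h1
  refine h1.ne' (integral_eq_zero_of_ae ?_)
  have hUae : Uᶜ ∈ ae lam := by rwa [mem_ae_iff, compl_compl]
  filter_upwards [hUae] with t ht using hf0 ht

end Hypergroup

/-! ### Pointwise limits in Orlicz spaces -/

namespace YoungFunction

variable (Φ : YoungFunction)

theorem compl_zero : Φ.compl 0 = 0 := by
  simp [compl, Φ.nonneg]

/-- The complementary function tends to `0` at `0`, since `Φ` grows at least linearly. -/
theorem exists_pos_compl_mul_le_one {M : ℝ≥0∞} (hM : M ≠ ∞) :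
    ∃ c : ℝ, 0 < c ∧ Φ.compl c * M ≤ 1 := by
  obtain ⟨y₀, hy₀, hΦ⟩ : ∃ y₀ : ℝ, 0 < y₀ ∧ 1 ≤ Φ y₀ := by
    obtain ⟨y, hy⟩ := ((Φ.tendsto_atTop.eventually_ge_atTop 1).and (eventually_gt_atTop 0)).exists
    exact ⟨y, hy.2, hy.1⟩
  -- Convexity and `Φ 0 = 0` give `Φ y ≥ y / y₀` beyond `y₀`, hence `y / y₀ - Φ y ≤ 1` everywhere.
  have hlin : ∀ y, 0 ≤ y → y / y₀ - Φ y ≤ 1 := by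
    intro y hy
    rcases le_total y y₀ with h | h
    · have h1 : y / y₀ ≤ 1 := (div_le_one hy₀).2 h
      linarith [Φ.nonneg y]
    · have hy' : 0 < y := hy₀.trans_le h
      have h1 := Φ.convex.2 (mem_univ 0) (mem_univ y)
        (show 0 ≤ 1 - y₀ / y by rw [sub_nonneg, div_le_one hy']; exact h)
        (show 0 ≤ y₀ / y by positivity) (by ring)
      simp only [smul_eq_mul, mul_zero, zero_add, Φ.map_zero] at h1
      rw [div_mul_cancel₀ _ hy'.ne'] at h1
      have h2 : y / y₀ ≤ Φ y := by
        rw [div_le_iff₀ hy₀]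
        have h3 := mul_le_mul_of_nonneg_left (hΦ.trans h1) hy
        have e : y * (y₀ / y * Φ y) = Φ y * y₀ := by field_simp
        linarith
      linarith
  obtain ⟨m, hm⟩ : ∃ m : ℝ, 1 ≤ m ∧ M ≤ ENNReal.ofReal m :=
    ⟨max 1 M.toReal, le_max_left _ _, by
      rw [← ENNReal.ofReal_toReal hM]
      exact ENNReal.ofReal_le_ofReal (by simp)⟩
  have hm0 : 0 < m := one_pos.trans_le hm.1
  refine ⟨m⁻¹ / y₀, by positivity, ?_⟩
  have hc : Φ.compl (m⁻¹ / y₀) ≤ ENNReal.ofReal m⁻¹ := by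
    refine iSup₂_le fun y hy => ENNReal.ofReal_le_ofReal ?_
    have h1 := mul_le_mul_of_nonneg_left (hlin y hy) (inv_pos.2 hm0).le
    have h2 : m⁻¹ * Φ y ≤ Φ y := mul_le_of_le_one_left (Φ.nonneg y) (inv_le_one_of_one_le₀ hm.1)
    rw [abs_of_nonneg (by positivity)]
    have e : y * (m⁻¹ / y₀) = m⁻¹ * (y / y₀) := by ring
    rw [e]
    linarith
  calc Φ.compl (m⁻¹ / y₀) * M ≤ ENNReal.ofReal m⁻¹ * ENNReal.ofReal m := by
        gcongr
        exact hm.2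
    _ = 1 := by
        rw [← ENNReal.ofReal_mul (by positivity), inv_mul_cancel₀ hm0.ne', ENNReal.ofReal_one]

end YoungFunction

namespace Hypergroup

variable {K : Type*} [TopologicalSpace K] [T2Space K] [LocallyCompactSpace K]
  [MeasurableSpace K] [BorelSpace K] [Hypergroup K] {lam : Measure K} {Φ : YoungFunction}
  {w : Weight K}

theorem aemeasurable_weight_mul {k v : K → ℂ} (hk : AEStronglyMeasurable k lam)
    (hv : Measurable v) : AEMeasurable (fun x => ENNReal.ofReal (w x * ‖k x‖ * ‖v x‖)) lam :=
  ((w.continuous_toFun.measurable.aemeasurable.mul hk.norm.aemeasurable).mul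
    hv.norm.aemeasurable).ennreal_ofReal

/-- Test functions that are small constants on `D` show that the Orlicz norm sees every set `D` of
finite measure. -/
theorem ae_eq_zero_of_orliczNorm_eq_zero {k : K → ℂ} (hk : AEStronglyMeasurable k lam)
    (h0 : orliczNorm lam Φ w k = 0) {D : Set K} (hD : MeasurableSet D) (hDf : lam D ≠ ∞) :
    ∀ᵐ x ∂lam, x ∈ D → k x = 0 := by
  obtain ⟨c, hc, hcD⟩ := Φ.exists_pos_compl_mul_le_one hDf
  set v : K → ℂ := D.indicator fun _ => (c : ℂ)
  have hv : Measurable v := measurable_const.indicator hD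
  have hv1 : ∫⁻ x, Φ.compl ‖v x‖ ∂lam ≤ 1 := by
    have h : (fun x => Φ.compl ‖v x‖) = D.indicator fun _ => Φ.compl c := by
      ext x
      by_cases hx : x ∈ D
      · simp [v, hx, abs_of_pos hc]
      · simp [v, hx, Φ.compl_zero]
    rw [h, lintegral_indicator_const hD]
    exact hcD
  have h1 : ∫⁻ x, ENNReal.ofReal (w x * ‖k x‖ * ‖v x‖) ∂lam = 0 := by
    refine le_antisymm ?_ (zero_le)
    rw [← h0]
    exact le_iSup_of_le v (le_iSup_of_le hv (le_iSup_of_le hv1 le_rfl))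
  rw [lintegral_eq_zero_iff' (aemeasurable_weight_mul hk hv)] at h1
  filter_upwards [h1] with x hx hxD
  have h2 : w x * ‖k x‖ * ‖v x‖ ≤ 0 := ENNReal.ofReal_eq_zero.1 hx
  have h3 : ‖v x‖ = c := by simp [v, hxD, abs_of_pos hc]
  rw [h3] at h2
  by_contra hne
  have := mul_pos (mul_pos (w.pos x) (norm_pos_iff.2 hne)) hc
  linarith

/-- Fatou's lemma for the Orlicz norm. -/
theorem orliczNorm_le_liminf {k : ℕ → K → ℂ} {F : K → ℂ}
    (hk : ∀ n, AEStronglyMeasurable (k n) lam)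
    (hF : ∀ᵐ x ∂lam, Tendsto (fun n => k n x) atTop (𝓝 (F x))) :
    orliczNorm lam Φ w F ≤ liminf (fun n => orliczNorm lam Φ w (k n)) atTop := by
  refine iSup_le fun v => iSup_le fun hv => iSup_le fun hv1 => ?_
  have h1 : ∀ᵐ x ∂lam, liminf (fun n => ENNReal.ofReal (w x * ‖k n x‖ * ‖v x‖)) atTop =
      ENNReal.ofReal (w x * ‖F x‖ * ‖v x‖) := by
    filter_upwards [hF] with x hx
    exact (ENNReal.tendsto_ofReal ((hx.norm.const_mul _).mul_const _)).liminf_eq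
  rw [← lintegral_congr_ae h1]
  refine (lintegral_liminf_le' fun n => aemeasurable_weight_mul (hk n) hv).trans ?_
  exact liminf_le_liminf (Eventually.of_forall fun n =>
    le_iSup_of_le v (le_iSup_of_le hv (le_iSup_of_le hv1 le_rfl)))

theorem ofReal_norm_weightedOrlicz (f : weightedOrlicz lam Φ w) :
    ENNReal.ofReal ‖f‖ = orliczNorm lam Φ w (f : K →ₘ[lam] ℂ) :=
  ENNReal.ofReal_toReal (orliczNorm_ne_top f)

/-- A pointwise limit of elements of a compact set `S` is in the Orlicz space and in the closure of
`S`, if it vanishes off a countable union of sets of finite measure. Without the last condition it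
could differ from an element of `S` on a set of infinite measure that the norm does not see. -/
theorem exists_mem_closure_of_tendsto {S : Set (weightedOrlicz lam Φ w)} (hS : IsCompact S)
    {u : ℕ → weightedOrlicz lam Φ w} (hu : ∀ n, u n ∈ S) {F : K → ℂ}
    (hF : ∀ᵐ x ∂lam, Tendsto (fun n => (u n : K →ₘ[lam] ℂ) x) atTop (𝓝 (F x)))
    {D : ℕ → Set K} (hD : ∀ n, MeasurableSet (D n)) (hDf : ∀ n, lam (D n) ≠ ∞)
    (hFD : ∀ x, (∀ n, x ∉ D n) → F x = 0) :
    ∃ v : weightedOrlicz lam Φ w, (v : K →ₘ[lam] ℂ) =ᵐ[lam] F ∧ v ∈ closure S := by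
  obtain ⟨h, hhS, φ, hφ, hlim⟩ := hS.tendsto_subseq hu
  have hFm : AEStronglyMeasurable F lam :=
    aestronglyMeasurable_of_tendsto_ae atTop (fun n => (u n : K →ₘ[lam] ℂ).aestronglyMeasurable) hF
  set H : K → ℂ := ⇑(h : K →ₘ[lam] ℂ)
  have hHm : AEStronglyMeasurable H lam := (h : K →ₘ[lam] ℂ).aestronglyMeasurable
  have hnorm : orliczNorm lam Φ w (F - H) = 0 := by
    refine le_antisymm ?_ zero_le
    have h1 := orliczNorm_le_liminf (Φ := Φ) (w := w) (F := F - H)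
      (k := fun n => ⇑((u (φ n) - h : weightedOrlicz lam Φ w) : K →ₘ[lam] ℂ))
      (fun n => AEEqFun.aestronglyMeasurable _) (by
        have hsub : ∀ᵐ x ∂lam, ∀ n, ((u (φ n) - h : weightedOrlicz lam Φ w) : K →ₘ[lam] ℂ) x =
            (u (φ n) : K →ₘ[lam] ℂ) x - H x :=
          ae_all_iff.2 fun n => AEEqFun.coeFn_sub (u (φ n) : K →ₘ[lam] ℂ) (h : K →ₘ[lam] ℂ)
        filter_upwards [hF, hsub] with x hx hs
        simp only [hs, Pi.sub_apply]
        exact (hx.comp hφ.tendsto_atTop).sub_const _)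
    refine h1.trans_eq ?_
    simp_rw [← ofReal_norm_weightedOrlicz]
    have h2 := ENNReal.tendsto_ofReal (tendsto_iff_norm_sub_tendsto_zero.1 hlim)
    rw [ENNReal.ofReal_zero] at h2
    exact h2.liminf_eq
  have hFH : ∀ᵐ x ∂lam, F x = H x ∨ F x = 0 := by
    have h1 : ∀ᵐ x ∂lam, ∀ n, x ∈ D n → (F - H) x = 0 := ae_all_iff.2 fun n =>
      ae_eq_zero_of_orliczNorm_eq_zero (hFm.sub hHm) hnorm (hD n) (hDf n)
    filter_upwards [h1] with x hx
    by_cases hxD : ∃ n, x ∈ D n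
    · obtain ⟨n, hn⟩ := hxD
      exact Or.inl (sub_eq_zero.1 (hx n hn))
    · exact Or.inr (hFD x (not_exists.1 hxD))
  have hmk : ⇑(AEEqFun.mk F hFm) =ᵐ[lam] F := AEEqFun.coeFn_mk F hFm
  have hmem : AEEqFun.mk F hFm ∈ weightedOrlicz lam Φ w := by
    obtain ⟨α, hα, hfin⟩ := h.2
    refine ⟨α, hα, lt_of_le_of_lt (lintegral_mono_ae ?_) hfin⟩
    filter_upwards [hFH, hmk] with x hx hx'
    rw [hx']
    rcases hx with hx | hx
    · rw [hx]
    · simp [hx, Φ.map_zero]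
  refine ⟨⟨_, hmem⟩, hmk, Metric.mem_closure_iff.2 fun ε hε => ⟨h, hhS, ?_⟩⟩
  have h0 : ‖(⟨_, hmem⟩ - h : weightedOrlicz lam Φ w)‖ = 0 := by
    rw [weightedOrlicz_norm_def, Submodule.coe_sub]
    rw [orliczNorm_congr ((AEEqFun.coeFn_sub _ _).trans (hmk.sub (ae_eq_refl _))), hnorm,
      ENNReal.toReal_zero]
  rw [dist_eq_norm, h0]
  exact hε

end Hypergroup

/-! ### Integration against complex measures -/

/-- Two ways to integrate bounded functions against a complex measure agree if they agree on
indicator functions. -/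
theorem integral_complexMeasure_eq {K : Type*} [MeasurableSpace K] {μ : ComplexMeasure K}
    [IsFiniteMeasure μ.variation] {I : (K → ℂ) → ℂ}
    (hind : ∀ (c : ℂ) (s : Set K), MeasurableSet s → I (s.indicator fun _ => c) = c * μ s)
    (hadd : ∀ f g : SimpleFunc K ℂ, I (f + g) = I f + I g)
    (hlim : ∀ (F : ℕ → SimpleFunc K ℂ) (f : K → ℂ) (C : ℝ), (∀ n x, ‖F n x‖ ≤ C) →
      (∀ x, Tendsto (fun n => F n x) atTop (𝓝 (f x))) →
      Tendsto (fun n => I (F n)) atTop (𝓝 (I f)))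
    {f : K → ℂ} (hf : StronglyMeasurable f) {C : ℝ} (hC : ∀ x, ‖f x‖ ≤ C) :
    μ.integral f (ContinuousLinearMap.mul ℝ ℂ) = I f := by
  have hint : ∀ F : SimpleFunc K ℂ, μ.Integrable F := fun F => F.integrable_of_isFiniteMeasure
  have hsimple : ∀ F : SimpleFunc K ℂ, μ.integral F (ContinuousLinearMap.mul ℝ ℂ) = I F := by
    intro F
    induction F using SimpleFunc.induction with
    | const c hs =>
      rename_i s
      classical
      have e : ⇑(SimpleFunc.piecewise s hs (SimpleFunc.const K c) (SimpleFunc.const K 0)) =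
          s.indicator fun _ => c := by
        ext x
        by_cases hx : x ∈ s <;> simp [hx]
      rw [e, hind c s hs]
      change (μ.integral (fun x => s.indicator (fun _ => c) x) (ContinuousLinearMap.mul ℝ ℂ)) = _
      rw [VectorMeasure.integral_indicator hs, VectorMeasure.integral_const]
      simp [VectorMeasure.restrict_apply, hs]
    | add hd hf hg =>
      rw [SimpleFunc.coe_add, hadd, ← hf, ← hg]
      exact VectorMeasure.integral_add (hint _) (hint _)
  rcases isEmpty_or_nonempty K with hK | ⟨⟨x₀⟩⟩
  · have h := hsimple 0
    have e : ((0 : SimpleFunc K ℂ) : K → ℂ) = f := Subsingleton.elim _ _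
    rwa [e] at h
  have hC0 : 0 ≤ C := (norm_nonneg _).trans (hC x₀)
  have hb := hf.norm_approxBounded_le hC0
  have ht : ∀ x, Tendsto (fun n => hf.approxBounded C n x) atTop (𝓝 (f x)) := fun x =>
    hf.tendsto_approxBounded_of_norm_le (hC x)
  have h1 := VectorMeasure.tendsto_integral_of_dominated_convergence (μ := μ)
    (B := ContinuousLinearMap.mul ℝ ℂ) (f := f)
    (fun _ => C) (fun n => (hf.approxBounded C n).stronglyMeasurable.aestronglyMeasurable)
    (integrable_const C) (fun n => Eventually.of_forall (hb n)) (Eventually.of_forall ht)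
  have h2 := hlim (hf.approxBounded C) f C hb ht
  refine tendsto_nhds_unique h1 (h2.congr fun n => (hsimple _).symm)

theorem integral_smul_complexMeasure {K : Type*} [MeasurableSpace K] {μ : ComplexMeasure K}
    [IsFiniteMeasure μ.variation] (c : ℂ) {f : K → ℂ} (hf : StronglyMeasurable f) {C : ℝ}
    (hC : ∀ x, ‖f x‖ ≤ C) :
    (c • μ).integral f (ContinuousLinearMap.mul ℝ ℂ) =
      c * μ.integral f (ContinuousLinearMap.mul ℝ ℂ) := by
  have hint : ∀ F : SimpleFunc K ℂ, μ.Integrable F := fun F => F.integrable_of_isFiniteMeasure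
  refine integral_complexMeasure_eq (I := fun f => c * μ.integral f (ContinuousLinearMap.mul ℝ ℂ))
    ?_ ?_ ?_ hf hC
  · intro d s hs
    change c * (μ.integral (fun x => s.indicator (fun _ => d) x) (ContinuousLinearMap.mul ℝ ℂ)) = _
    rw [VectorMeasure.integral_indicator hs, VectorMeasure.integral_const]
    simp [VectorMeasure.restrict_apply, hs]
    ring
  · intro F G
    rw [← mul_add]
    congr 1
    exact VectorMeasure.integral_add (hint _) (hint _)
  · intro F f C hF hlim
    exact (VectorMeasure.tendsto_integral_of_dominated_convergence (fun _ => C)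
      (fun n => (F n).stronglyMeasurable.aestronglyMeasurable) (integrable_const C)
      (fun n => Eventually.of_forall (hF n)) (Eventually.of_forall hlim)).const_mul c

theorem integral_withDensityᵥ {K : Type*} [MeasurableSpace K] {lam : Measure K} {u : K → ℂ}
    (hu : Integrable u lam) {f : K → ℂ} (hf : StronglyMeasurable f) {C : ℝ}
    (hC : ∀ x, ‖f x‖ ≤ C) :
    (lam.withDensityᵥ u : ComplexMeasure K).integral f (ContinuousLinearMap.mul ℝ ℂ) =
      ∫ y, u y * f y ∂lam := by
  have hfin : IsFiniteMeasure (lam.withDensityᵥ u : ComplexMeasure K).variation := by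
    rw [Measure.variation_withDensityᵥ hu]
    exact ⟨by simpa using! hu.2⟩
  have hint : ∀ F : SimpleFunc K ℂ, Integrable (fun y => u y * F y) lam := fun F =>
    let ⟨C, hC⟩ := F.exists_forall_norm_le
    hu.mul_bdd F.stronglyMeasurable.aestronglyMeasurable (Eventually.of_forall hC)
  refine integral_complexMeasure_eq (I := fun f => ∫ y, u y * f y ∂lam) ?_ ?_ ?_ hf hC
  · intro c s hs
    rw [withDensityᵥ_apply hu hs, ← integral_const_mul, ← integral_indicator hs]
    congr 1
    ext y
    by_cases hy : y ∈ s <;> simp [hy, mul_comm]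
  · intro F G
    rw [← integral_add (hint F) (hint G)]
    simp [mul_add]
  · intro F f C hF hlim
    refine tendsto_integral_of_dominated_convergence (fun y => ‖u y‖ * C)
      (fun n => (hint (F n)).aestronglyMeasurable) (hu.norm.mul_const C)
      (fun n => Eventually.of_forall fun y => ?_)
      (Eventually.of_forall fun y => (hlim y).const_mul _)
    rw [norm_mul]
    gcongr
    exact hF n y

/-- An integrable function lives on a `σ`-compact set. -/
theorem exists_monotone_isCompact_exhaustion {K E : Type*} [TopologicalSpace K] [T2Space K]
    [MeasurableSpace K] [BorelSpace K] [NormedAddCommGroup E] {m : Measure K} [m.Regular]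
    {u : K → E} (hu : Integrable u m) :
    ∃ C : ℕ → Set K, Monotone C ∧ (∀ n, IsCompact (C n)) ∧
      ∀ᵐ x ∂m, u x ≠ 0 → ∃ n, x ∈ C n := by
  obtain ⟨v, hv, huv⟩ := hu.aestronglyMeasurable
  have hvi : Integrable v m := hu.congr huv
  let A : ℕ → Set K := fun k => {x | 1 / ((k : ℝ) + 1) ≤ ‖v x‖}
  have hA : ∀ k, MeasurableSet (A k) := fun k =>
    measurableSet_le measurable_const hv.norm.measurable
  have hAf : ∀ k, m (A k) ≠ ∞ := fun k =>
    (hvi.norm.measure_ge_lt_top (show 0 < 1 / ((k : ℝ) + 1) by positivity)).ne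
  have hε : ∀ j : ℕ, ((j : ℝ≥0∞) + 1)⁻¹ ≠ 0 := fun j => by simp
  choose B hBA hB hBm using fun k j => (hA k).exists_isCompact_sdiff_lt (hAf k) (hε j)
  refine ⟨accumulate fun n => ⋃ k ∈ Finset.range (n + 1), ⋃ j ∈ Finset.range (n + 1), B k j,
    monotone_accumulate, fun n => ?_, ?_⟩
  · exact (finite_Iic n).isCompact_biUnion fun i _ => Finset.isCompact_biUnion _ fun k _ =>
      Finset.isCompact_biUnion _ fun j _ => hB k j
  · have hnull : ∀ k, m (A k \ ⋃ j, B k j) = 0 := by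
      intro k
      refine le_antisymm (ENNReal.le_of_forall_pos_le_add fun ε hε _ => ?_) zero_le
      obtain ⟨j, hj⟩ := ENNReal.exists_inv_nat_lt (ENNReal.coe_pos.2 hε).ne'
      rw [zero_add]
      calc m (A k \ ⋃ j, B k j) ≤ m (A k \ B k j) :=
            measure_mono (sdiff_subset_sdiff_right (subset_iUnion _ j))
        _ ≤ ((j : ℝ≥0∞) + 1)⁻¹ := (hBm k j).le
        _ ≤ (j : ℝ≥0∞)⁻¹ := ENNReal.inv_le_inv.2 le_self_add
        _ ≤ ε := hj.le
    have h1 : ∀ᵐ x ∂m, ∀ k, x ∉ A k \ ⋃ j, B k j :=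
      ae_all_iff.2 fun k => measure_eq_zero_iff_ae_notMem.1 (hnull k)
    filter_upwards [h1, huv] with x hx hxv hne
    rw [hxv] at hne
    obtain ⟨k, hk⟩ := exists_nat_one_div_lt (norm_pos_iff.2 hne)
    have h2 : x ∈ ⋃ j, B k j := by
      by_contra h
      exact hx k ⟨hk.le, h⟩
    obtain ⟨j, hj⟩ := mem_iUnion.1 h2
    refine ⟨max k j, mem_accumulate.2 ⟨max k j, le_rfl, ?_⟩⟩
    simp only [mem_iUnion, Finset.mem_range]
    exact ⟨k, Nat.lt_succ_of_le (le_max_left _ _), j, Nat.lt_succ_of_le (le_max_right _ _), hj⟩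

namespace Hypergroup

variable {K : Type*} [TopologicalSpace K] [T2Space K] [LocallyCompactSpace K]
  [MeasurableSpace K] [BorelSpace K] [Hypergroup K] {lam : Measure K} {Φ : YoungFunction}
  {w : Weight K}

/-- A family of functions that is linear almost everywhere and sends the unit ball into a compact
set of the Orlicz space is a compact operator. -/
theorem exists_compact_operator {E : Type*} [SeminormedAddCommGroup E] [NormedSpace ℂ E]
    {R : E → K → ℂ} (hadd : ∀ f g, R (f + g) =ᵐ[lam] R f + R g)
    (hsmul : ∀ (c : ℂ) f, R (c • f) =ᵐ[lam] c • R f)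
    {S : Set (weightedOrlicz lam Φ w)} (hS : IsCompact S)
    (hR : ∀ f, ‖f‖ ≤ 1 → ∃ v ∈ S, (v : K →ₘ[lam] ℂ) =ᵐ[lam] R f) :
    ∃ T : E →L[ℂ] weightedOrlicz lam Φ w, IsCompactOperator T ∧
      ∀ f, (T f : K →ₘ[lam] ℂ) =ᵐ[lam] R f := by
  -- `f` is scaled by `‖f‖ + 1`, as `E` may contain nonzero elements of norm zero.
  have hex : ∀ f, ∃ v : weightedOrlicz lam Φ w, (v : K →ₘ[lam] ℂ) =ᵐ[lam] R f := by
    intro f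
    have hpos : 0 < ‖f‖ + 1 := by positivity
    have hne : ((‖f‖ + 1 : ℝ) : ℂ) ≠ 0 := Complex.ofReal_ne_zero.2 hpos.ne'
    obtain ⟨v, -, hv⟩ := hR (((‖f‖ + 1 : ℝ) : ℂ)⁻¹ • f) (by
      rw [norm_smul, norm_inv, Complex.norm_real, Real.norm_of_nonneg hpos.le,
        inv_mul_le_iff₀ hpos]
      linarith)
    refine ⟨((‖f‖ + 1 : ℝ) : ℂ) • v, ?_⟩
    have h1 := hsmul ((‖f‖ + 1 : ℝ) : ℂ) (((‖f‖ + 1 : ℝ) : ℂ)⁻¹ • f)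
    rw [smul_inv_smul₀ hne] at h1
    refine (AEEqFun.coeFn_smul _ _).trans (EventuallyEq.trans ?_ h1.symm)
    filter_upwards [hv] with x hx
    simp [hx]
  choose T₀ hT₀ using hex
  have huniq : ∀ {v v' : weightedOrlicz lam Φ w} {F : K → ℂ},
      (v : K →ₘ[lam] ℂ) =ᵐ[lam] F → (v' : K →ₘ[lam] ℂ) =ᵐ[lam] F → v = v' :=
    fun h h' => Subtype.ext (AEEqFun.ext (h.trans h'.symm))
  let L : E →ₗ[ℂ] weightedOrlicz lam Φ w :=
    { toFun := T₀
      map_add' := fun f g => huniq ((hT₀ _).trans (hadd f g))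
        ((AEEqFun.coeFn_add _ _).trans ((hT₀ f).add (hT₀ g)))
      map_smul' := fun c f => huniq ((hT₀ _).trans (hsmul c f))
        ((AEEqFun.coeFn_smul _ _).trans ((hT₀ f).const_smul c)) }
  have hL : IsCompactOperator L := by
    rw [isCompactOperator_iff_image_closedBall_subset_compact L one_pos]
    refine ⟨S, hS, ?_⟩
    rintro _ ⟨f, hf, rfl⟩
    obtain ⟨v, hvS, hv⟩ := hR f (by simpa using hf)
    have : L f = v := huniq (hT₀ f) hv
    rwa [this]
  exact ⟨ContinuousLinearMap.mkOfIsCompactOperator hL, hL, hT₀⟩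

end Hypergroup

/-! ### From measures to functions -/

namespace Hypergroup

variable {K : Type*} [TopologicalSpace K] [T2Space K] [LocallyCompactSpace K]
  [MeasurableSpace K] [BorelSpace K] [Hypergroup K] {lam : Measure K} {Φ : YoungFunction}
  {w : Weight K} {g : K → ℂ}

theorem Weight.measurable (w : Weight K) : Measurable fun x => ENNReal.ofReal (w x) :=
  w.continuous_toFun.measurable.ennreal_ofReal

theorem absolutelyContinuous_weight (lam : Measure K) (w : Weight K) :
    lam ≪ lam.withDensity fun x => ENNReal.ofReal (w x) :=
  withDensity_absolutelyContinuous' w.measurable.aemeasurable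
    (Eventually.of_forall fun x => (ENNReal.ofReal_pos.2 (w.pos x)).ne')

theorem continuous_translate (hg : Continuous g) (hgc : HasCompactSupport g) (x : K) :
    Continuous fun y => evalConv g (inv y) x := by
  have h := continuous_evalConv_inv hg hgc
  have h2 : Continuous fun y : K => (y, x) := Continuous.prodMk_left x
  have h3 := h.comp h2
  exact h3

theorem integrable_weight_smul (f : WeightedL1 lam w) :
    Integrable (fun y => (w y : ℂ) * f y) lam := by
  have h := L1.integrable_coeFn f
  rw [integrable_withDensity_iff_integrable_smul' w.measurable
    (Eventually.of_forall fun x => ENNReal.ofReal_lt_top)] at h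
  refine h.congr (Eventually.of_forall fun x => ?_)
  simp [ENNReal.toReal_ofReal (w.pos x).le]

/-- Functions in `L^1_w(K)` are locally integrable, since `w` is bounded below on compact sets. -/
theorem integrable_mul_of_hasCompactSupport (f : WeightedL1 lam w) {h : K → ℂ}
    (hh : Continuous h) (hhc : HasCompactSupport h) : Integrable (fun y => f y * h y) lam := by
  have hwc : Continuous fun y => (w y : ℂ)⁻¹ :=
    (Complex.continuous_ofReal.comp w.continuous_toFun).inv₀
      fun y => Complex.ofReal_ne_zero.2 (w.pos y).ne'
  obtain ⟨M, hM⟩ := (hwc.mul hh).bounded_above_of_compact_support hhc.mul_left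
  refine ((integrable_weight_smul f).mul_bdd (hwc.mul hh).aestronglyMeasurable
    (Eventually.of_forall hM)).congr (Eventually.of_forall fun y => ?_)
  have := Complex.ofReal_ne_zero.2 (w.pos y).ne'
  simp only [Pi.mul_apply]
  field_simp

/-- The `L^1_w`-norm of `u` is the `M_w`-norm of the measure `u lam`. -/
theorem lintegral_enorm_mul_weight (u : K → ℂ) (hu : AEStronglyMeasurable u lam) :
    ∫⁻ x, ‖u x‖ₑ ∂(lam.withDensity fun x => ENNReal.ofReal (w x)) =
      ∫⁻ x, ENNReal.ofReal (w x) ∂(lam.withDensity fun x => ‖u x‖ₑ) := by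
  rw [lintegral_withDensity_eq_lintegral_mul₀' w.measurable.aemeasurable
      (hu.mono_ac (withDensity_absolutelyContinuous _ _)).enorm,
    lintegral_withDensity_eq_lintegral_mul₀' hu.enorm w.measurable.aemeasurable]
  simp_rw [Pi.mul_apply, mul_comm]

/-- A bounded function vanishing off a compact set gives an element of `M_w(K)`. -/
theorem withDensityᵥ_mem_weightedMeasures [lam.Regular] {u : K → ℂ} (hu : Integrable u lam)
    {C : Set K} (hC : IsCompact C) {M : ℝ≥0} (huM : ∀ x, ‖u x‖₊ ≤ M) (huC : ∀ x ∉ C, u x = 0) :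
    (lam.withDensityᵥ u : ComplexMeasure K) ∈ weightedMeasures w := by
  have hle : (lam.withDensityᵥ u : ComplexMeasure K).variation ≤ M • lam.restrict C := by
    rw [Measure.variation_withDensityᵥ hu]
    refine Measure.le_iff.2 fun A hA => ?_
    rw [withDensity_apply _ hA, Measure.smul_apply, Measure.restrict_apply hA]
    calc ∫⁻ x in A, ‖u x‖ₑ ∂lam ≤ ∫⁻ x in A, C.indicator (fun _ => (M : ℝ≥0∞)) x ∂lam := by
          refine lintegral_mono fun x => ?_
          by_cases hx : x ∈ C
          · simpa [hx, enorm_eq_nnnorm] using huM x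
          · simp [hx, huC x hx]
      _ = M • lam (A ∩ C) := by
          rw [lintegral_indicator hC.measurableSet, lintegral_const,
            Measure.restrict_apply_univ, Measure.restrict_apply hC.measurableSet, inter_comm]
          rfl
  have hCf : lam C ≠ ∞ := hC.measure_lt_top.ne
  have hfin : IsFiniteMeasure (lam.restrict C) := ⟨by simpa using hC.measure_lt_top⟩
  have hreg : (lam.restrict C).Regular := Measure.Regular.restrict_of_measure_ne_top hCf
  have hfin' := isFiniteMeasure_of_le _ hle
  refine ⟨⟨hfin', regular_of_le hle⟩, ?_⟩
  obtain ⟨B, hB⟩ := hC.bddAbove_image w.continuous_toFun.continuousOn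
  calc ∫⁻ x, ENNReal.ofReal (w x) ∂(lam.withDensityᵥ u : ComplexMeasure K).variation
      ≤ ∫⁻ x, ENNReal.ofReal (w x) ∂(M • lam.restrict C) := lintegral_mono' hle le_rfl
    _ = M * ∫⁻ x in C, ENNReal.ofReal (w x) ∂lam := by
        rw [lintegral_smul_measure]
        rfl
    _ ≤ M * (ENNReal.ofReal B * lam C) := by
        gcongr
        rw [← setLIntegral_const]
        exact setLIntegral_mono' hC.measurableSet fun x hx =>
          ENNReal.ofReal_le_ofReal (hB (mem_image_of_mem _ hx))
    _ < ∞ := ENNReal.mul_lt_top ENNReal.coe_lt_top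
        (ENNReal.mul_lt_top ENNReal.ofReal_lt_top hC.measure_lt_top)

/-- A function `f` in the unit ball of `L^1_w(K)` is approximated by bounded truncations `u n` with
compact support; the measures `u n • lam` are in the unit ball of `M_w(K)`, and their convolutions
with `g` converge pointwise to `f * g`. -/
theorem exists_functionConvolution_of_measureConvolution [lam.Regular] (hg : Continuous g)
    (hgc : HasCompactSupport g)
    (h : ∃ T : weightedMeasures w →L[ℂ] weightedOrlicz lam Φ w,
      IsMeasureConvolution g T ∧ IsCompactOperator T) :
    ∃ T : WeightedL1 lam w →L[ℂ] weightedOrlicz lam Φ w,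
      IsFunctionConvolution g T ∧ IsCompactOperator T := by
  obtain ⟨T, hT, hTc⟩ := h
  obtain ⟨S, hS, hTS⟩ := IsCompactOperator.image_closedBall_subset_compact
    (f := (T : weightedMeasures w →ₗ[ℂ] weightedOrlicz lam Φ w)) hTc 1
  obtain ⟨M, hM⟩ := hg.bounded_above_of_compact_support hgc
  have hint : ∀ (f : WeightedL1 lam w) (x : K),
      Integrable (fun y => f y * evalConv g (inv y) x) lam := fun f x =>
    integrable_mul_of_hasCompactSupport f (continuous_translate hg hgc x)
      (hasCompactSupport_evalConv_inv hgc x)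
  have hac := absolutelyContinuous_weight lam w
  suffices hex : ∃ T' : WeightedL1 lam w →L[ℂ] weightedOrlicz lam Φ w, IsCompactOperator T' ∧
      ∀ f, (T' f : K →ₘ[lam] ℂ) =ᵐ[lam] fun x => ∫ y, f y * evalConv g (inv y) x ∂lam by
    obtain ⟨T', hT'c, hT'⟩ := hex
    exact ⟨T', fun f => by filter_upwards [hT' f] with x hx using ⟨hint f x, hx⟩, hT'c⟩
  refine exists_compact_operator
    (R := fun (f : WeightedL1 lam w) x => ∫ y, f y * evalConv g (inv y) x ∂lam)
    ?_ ?_ hS.closure ?_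
  · refine fun f₁ f₂ => Eventually.of_forall fun x => ?_
    rw [Pi.add_apply, ← integral_add (hint f₁ x) (hint f₂ x)]
    refine integral_congr_ae ?_
    filter_upwards [hac.ae_le (Lp.coeFn_add f₁ f₂)] with y hy
    rw [hy, Pi.add_apply, add_mul]
  · refine fun c f => Eventually.of_forall fun x => ?_
    rw [Pi.smul_apply, smul_eq_mul, ← integral_const_mul]
    refine integral_congr_ae ?_
    filter_upwards [hac.ae_le (Lp.coeFn_smul c f)] with y hy
    rw [hy, Pi.smul_apply, smul_eq_mul, mul_assoc]
  · intro f hf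
    obtain ⟨C, hCm, hC, hfC⟩ := exists_monotone_isCompact_exhaustion (integrable_weight_smul f)
    have hfm : Measurable f := (Lp.stronglyMeasurable f).measurable
    -- Truncate `f` to a bounded function supported in `C n`.
    let B : ℕ → Set K := fun n => C n ∩ {y | ‖f y‖ ≤ n}
    have hB : ∀ n, MeasurableSet (B n) := fun n =>
      (hC n).measurableSet.inter (measurableSet_le hfm.norm measurable_const)
    let u : ℕ → K → ℂ := fun n => (B n).indicator f
    have hum : ∀ n, Measurable (u n) := fun n => hfm.indicator (hB n)
    have hub : ∀ n x, ‖u n x‖₊ ≤ (n : ℝ≥0) := by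
      intro n x
      by_cases hx : x ∈ B n
      · simpa [u, hx, ← NNReal.coe_le_coe] using hx.2
      · simp [u, hx]
    have huC : ∀ n, ∀ x ∉ C n, u n x = 0 := fun n x hx =>
      indicator_of_notMem (fun h => hx h.1) _
    have huf : ∀ n x, ‖u n x‖ ≤ ‖f x‖ := fun n x => norm_indicator_le_norm_self _ _
    have hui : ∀ n, Integrable (u n) lam := by
      intro n
      have h1 : IntegrableOn (u n) (C n) lam :=
        Measure.integrableOn_of_bounded (M := n) (hC n).measure_lt_top.ne
          (hum n).aestronglyMeasurable (Eventually.of_forall (hub n))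
      exact h1.integrable_of_forall_notMem_eq_zero (huC n)
    let ν : ℕ → weightedMeasures w := fun n =>
      ⟨lam.withDensityᵥ (u n), withDensityᵥ_mem_weightedMeasures (hui n) (hC n) (hub n) (huC n)⟩
    have hνn : ∀ n, ‖ν n‖ ≤ 1 := by
      intro n
      refine le_trans ?_ hf
      have h1 : ‖f‖ = (∫⁻ x, ‖f x‖ₑ ∂(lam.withDensity fun x => ENNReal.ofReal (w x))).toReal := by
        rw [L1.norm_def]
      rw [weightedMeasures_norm_def, h1]
      refine ENNReal.toReal_mono (L1.integrable_coeFn f).2.ne ?_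
      rw [show ((ν n : weightedMeasures w) : ComplexMeasure K) = lam.withDensityᵥ (u n) from rfl,
        Measure.variation_withDensityᵥ (hui n),
        ← lintegral_enorm_mul_weight _ (hum n).aestronglyMeasurable]
      exact lintegral_mono fun x => enorm_le_iff_norm_le.2 (huf n x)
    have hTν : ∀ n, ∀ᵐ x ∂lam, (T (ν n) : K →ₘ[lam] ℂ) x =
        ∫ y, u n y * evalConv g (inv y) x ∂lam := by
      intro n
      filter_upwards [hT (ν n)] with x hx
      rw [hx.2]
      exact integral_withDensityᵥ (hui n) (continuous_translate hg hgc x).stronglyMeasurable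
        (fun y => norm_evalConv_le hM _ _)
    have hfC' : ∀ᵐ y ∂lam, f y ≠ 0 → ∃ n, y ∈ C n := by
      filter_upwards [hfC] with y hy hne
      exact hy (mul_ne_zero (Complex.ofReal_ne_zero.2 (w.pos y).ne') hne)
    have hlim : ∀ᵐ x ∂lam, Tendsto (fun n => (T (ν n) : K →ₘ[lam] ℂ) x) atTop
        (𝓝 (∫ y, f y * evalConv g (inv y) x ∂lam)) := by
      filter_upwards [ae_all_iff.2 hTν] with x hx
      simp_rw [hx]
      refine tendsto_integral_of_dominated_convergence (fun y => ‖f y * evalConv g (inv y) x‖)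
        (fun n => (hum n).aestronglyMeasurable.mul
          (continuous_translate hg hgc x).aestronglyMeasurable) (hint f x).norm
        (fun n => Eventually.of_forall fun y => ?_) ?_
      · rw [norm_mul, norm_mul]
        gcongr
        exact huf n y
      · filter_upwards [hfC'] with y hy
        refine Tendsto.mul_const _ (tendsto_const_nhds.congr' ?_)
        by_cases hy0 : f y = 0
        · refine Eventually.of_forall fun n => ?_
          have h1 := huf n y
          rw [hy0, norm_zero] at h1
          rw [hy0]
          exact (norm_le_zero_iff.1 h1).symm
        · obtain ⟨n, hn⟩ := hy hy0
          obtain ⟨m, hm⟩ := exists_nat_ge ‖f y‖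
          filter_upwards [eventually_ge_atTop n, eventually_ge_atTop m] with k hk hk'
          have hyB : y ∈ B k := ⟨hCm hk hn, hm.trans (Nat.cast_le.2 hk')⟩
          simp [u, hyB]
    have hD := fun n => isCompact_biUnion_support (hC n) hgc.isCompact
    obtain ⟨v, hv, hvS⟩ := exists_mem_closure_of_tendsto hS
      (fun n => hTS ⟨ν n, by simpa using hνn n, rfl⟩) hlim
      (fun n => (hD n).measurableSet) (fun n => (hD n).measure_lt_top.ne) (fun x hx => by
        refine integral_eq_zero_of_ae ?_
        filter_upwards [hfC'] with y hy
        by_cases hy0 : f y = 0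
        · simp [hy0]
        · obtain ⟨n, hn⟩ := hy hy0
          simp [evalConv_inv_eq_zero_of_notMem hn (hx n)])
    exact ⟨v, hvS, hv⟩

end Hypergroup

/-! ### From functions to measures -/

namespace Hypergroup

variable {K : Type*} [TopologicalSpace K] [T2Space K] [LocallyCompactSpace K]
  [MeasurableSpace K] [BorelSpace K] [Hypergroup K] {lam : Measure K} {Φ : YoungFunction}
  {w : Weight K} {g : K → ℂ}

/-- `u` imitates the restriction of `μ` to `A`: it is supported in `V`, its `L^1_w`-norm is at most
twice the `M_w`-norm of the restriction, and `u * g` is uniformly close to the convolution of the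
restriction with `g`. -/
structure IsSmearing (lam : Measure K) (w : Weight K) (g : K → ℂ) (μ : ComplexMeasure K)
    (V : Set K) (ε : ℝ) (A : Set K) (u : K → ℂ) : Prop where
  integrable : Integrable u lam
  eq_zero : ∀ y ∉ V, u y = 0
  lintegral_le : ∫⁻ y, ‖u y‖ₑ * ENNReal.ofReal (w y) ∂lam ≤
    2 * ∫⁻ y in A, ENNReal.ofReal (w y) ∂μ.variation
  norm_sub_le : ∀ x, ‖(∫ y, u y * evalConv g (inv y) x ∂lam) -
    (μ.restrict A).integral (fun y => evalConv g (inv y) x) (ContinuousLinearMap.mul ℝ ℂ)‖ ≤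
      ε * μ.variation.real A

theorem integrable_mul_translate (hg : Continuous g) (hgc : HasCompactSupport g) {u : K → ℂ}
    (hu : Integrable u lam) (x : K) : Integrable (fun y => u y * evalConv g (inv y) x) lam := by
  obtain ⟨M, hM⟩ := hg.bounded_above_of_compact_support hgc
  exact hu.mul_bdd (continuous_translate hg hgc x).aestronglyMeasurable
    (Eventually.of_forall fun y => norm_evalConv_le hM _ _)

theorem integrable_translate (hg : Continuous g) (hgc : HasCompactSupport g)
    (μ : ComplexMeasure K) [IsFiniteMeasure μ.variation] (x : K) :
    μ.Integrable fun y => evalConv g (inv y) x := by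
  obtain ⟨M, hM⟩ := hg.bounded_above_of_compact_support hgc
  exact Integrable.of_bound (continuous_translate hg hgc x).aestronglyMeasurable M
    (Eventually.of_forall fun y => norm_evalConv_le hM _ _)

theorem IsSmearing.union (hg : Continuous g) (hgc : HasCompactSupport g) {μ : ComplexMeasure K}
    [IsFiniteMeasure μ.variation] {V A B : Set K} {ε : ℝ} {u v : K → ℂ}
    (hu : IsSmearing lam w g μ V ε A u) (hv : IsSmearing lam w g μ V ε B v) (hA : MeasurableSet A)
    (hB : MeasurableSet B) (hAB : Disjoint A B) : IsSmearing lam w g μ V ε (A ∪ B) (u + v) where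
  integrable := hu.integrable.add hv.integrable
  eq_zero y hy := by simp [hu.eq_zero y hy, hv.eq_zero y hy]
  lintegral_le := by
    rw [lintegral_union hB hAB, mul_add]
    refine le_trans ?_ (add_le_add hu.lintegral_le hv.lintegral_le)
    have hm : AEMeasurable (fun y => ‖u y‖ₑ * ENNReal.ofReal (w y)) lam :=
      hu.integrable.aestronglyMeasurable.enorm.mul w.measurable.aemeasurable
    rw [← lintegral_add_left' hm]
    refine lintegral_mono fun y => ?_
    rw [← add_mul]
    gcongr
    exact enorm_add_le _ _
  norm_sub_le x := by
    have h1 := integrable_mul_translate hg hgc hu.integrable x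
    have h2 := integrable_mul_translate hg hgc hv.integrable x
    have h3 := integrable_translate hg hgc μ x
    have e : ∫ y, (u + v) y * evalConv g (inv y) x ∂lam =
        (∫ y, u y * evalConv g (inv y) x ∂lam) + ∫ y, v y * evalConv g (inv y) x ∂lam := by
      rw [← integral_add h1 h2]
      simp [add_mul]
    rw [e, VectorMeasure.setIntegral_union hAB hA hB h3.integrableOn h3.integrableOn,
      add_sub_add_comm, measureReal_union hAB hB, mul_add]
    exact (norm_add_le _ _).trans (add_le_add (hu.norm_sub_le x) (hv.norm_sub_le x))

theorem IsSmearing.empty (μ : ComplexMeasure K) (V : Set K) (ε : ℝ) :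
    IsSmearing lam w g μ V ε ∅ 0 where
  integrable := integrable_zero _ _ _
  eq_zero _ _ := rfl
  lintegral_le := by simp
  norm_sub_le x := by simp

/-- Near each point, the mass of `μ` on a set may be spread uniformly over a small open set. -/
theorem exists_nhds_isSmearing [lam.Regular] [lam.IsOpenPosMeasure] (hg : Continuous g)
    (hgc : HasCompactSupport g) (μ : ComplexMeasure K) [IsFiniteMeasure μ.variation] {V : Set K}
    (hV : IsCompact V) {y : K} (hy : y ∈ interior V) {ε : ℝ} (hε : 0 < ε) :
    ∃ U : Set K, IsOpen U ∧ y ∈ U ∧ ∀ A ⊆ U, MeasurableSet A →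
      ∃ u, IsSmearing lam w g μ V ε A u := by
  have hD := isCompact_biUnion_support hV hgc.isCompact
  set D := ⋃ p ∈ V ×ˢ tsupport g, (pointConv p.1 p.2).support
  have hG := continuous_evalConv_inv hg hgc
  have hwy := w.pos y
  -- `D` contains the supports of all translates `g(z⁻ * ·)` with `z ∈ V`, so that uniform closeness
  -- on the compact set `D` is uniform closeness on `K`.
  have h1 : ∀ᶠ z in 𝓝 y, ∀ x ∈ D, ‖evalConv g (inv z) x - evalConv g (inv y) x‖ < ε / 2 := by
    refine hD.eventually_forall_of_forall_eventually fun x _ => ?_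
    have hc : Continuous fun p : K × K => ‖evalConv g (inv p.1) p.2 - evalConv g (inv y) p.2‖ := by
      have h2 : Continuous fun p : K × K => (y, p.2) := continuous_const.prodMk continuous_snd
      have h3 := hG.comp h2
      exact (hG.sub h3).norm
    exact hc.continuousAt.eventually_lt continuousAt_const (by simpa using half_pos hε)
  -- Any bounds with quotient at most `2`, the constant in `IsSmearing`, would do.
  have h2 : ∀ᶠ z in 𝓝 y, 3 / 4 * w y < w z ∧ w z < 5 / 4 * w y :=
    (w.continuous_toFun.continuousAt.eventually_const_lt (by linarith)).and
      (w.continuous_toFun.continuousAt.eventually_lt_const (by linarith))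
  obtain ⟨U, hU, hUo, hyU⟩ := eventually_nhds_iff.1
    ((h1.and h2).and (isOpen_interior.mem_nhds hy))
  have hUV : U ⊆ V := fun z hz => interior_subset (hU z hz).2
  have hclose : ∀ z ∈ U, ∀ x, ‖evalConv g (inv z) x - evalConv g (inv y) x‖ ≤ ε / 2 := by
    intro z hz x
    by_cases hx : x ∈ D
    · exact ((hU z hz).1.1 x hx).le
    · rw [evalConv_inv_eq_zero_of_notMem (hUV hz) hx,
        evalConv_inv_eq_zero_of_notMem (hUV hyU) hx, sub_self, norm_zero]
      exact (half_pos hε).le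
  have hUf : lam U ≠ ∞ := ((measure_mono hUV).trans_lt hV.measure_lt_top).ne
  have hU0 : lam U ≠ 0 := (hUo.measure_pos lam ⟨y, hyU⟩).ne'
  have hUr : 0 < lam.real U := ENNReal.toReal_pos hU0 hUf
  have hUm := hUo.measurableSet
  refine ⟨U, hUo, hyU, fun A hAU hA => ?_⟩
  set c : ℂ := μ A / (lam.real U : ℂ)
  have hc : (lam.real U : ℂ) * c = μ A := mul_div_cancel₀ _ (Complex.ofReal_ne_zero.2 hUr.ne')
  have hcn : ‖c‖ * lam.real U = ‖μ A‖ := by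
    rw [← hc, norm_mul, Complex.norm_real, Real.norm_of_nonneg hUr.le, mul_comm]
  have hce : ‖c‖ₑ * lam U = ‖μ A‖ₑ := by
    rw [← ofReal_norm, ← ofReal_norm, ← ENNReal.ofReal_toReal hUf,
      ← ENNReal.ofReal_mul (norm_nonneg _)]
    exact congrArg _ hcn
  have hμA : ‖μ A‖ ≤ μ.variation.real A := VectorMeasure.norm_measure_le_variation
  refine ⟨U.indicator fun _ => c, ?_, ?_, ?_, ?_⟩
  · exact (integrable_indicator_iff hUm).2 (integrableOn_const hUf)
  · exact fun z hz => indicator_of_notMem (fun h => hz (hUV h)) _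
  · have e : (fun z => ‖U.indicator (fun _ => c) z‖ₑ * ENNReal.ofReal (w z)) =
        U.indicator fun z => ‖c‖ₑ * ENNReal.ofReal (w z) := by
      ext z
      by_cases hz : z ∈ U <;> simp [hz]
    rw [e, lintegral_indicator hUm]
    calc ∫⁻ z in U, ‖c‖ₑ * ENNReal.ofReal (w z) ∂lam
        ≤ ∫⁻ z in U, ‖c‖ₑ * ENNReal.ofReal (5 / 4 * w y) ∂lam := by
          refine setLIntegral_mono' hUm fun z hz => ?_
          gcongr
          exact (hU z hz).1.2.2.le
      _ = ‖μ A‖ₑ * ENNReal.ofReal (5 / 4 * w y) := by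
          rw [setLIntegral_const, ← hce]
          ring
      _ ≤ μ.variation A * ENNReal.ofReal (2 * (3 / 4 * w y)) := by
          exact mul_le_mul' (VectorMeasure.enorm_measure_le_variation μ A)
            (ENNReal.ofReal_le_ofReal (by linarith))
      _ = 2 * ∫⁻ z in A, ENNReal.ofReal (3 / 4 * w y) ∂μ.variation := by
          rw [setLIntegral_const, ENNReal.ofReal_mul zero_le_two, ENNReal.ofReal_ofNat]
          ring
      _ ≤ 2 * ∫⁻ z in A, ENNReal.ofReal (w z) ∂μ.variation := by
          gcongr 2 * ?_
          exact setLIntegral_mono' hA fun z hz =>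
            ENNReal.ofReal_le_ofReal (hU z (hAU hz)).1.2.1.le
  · intro x
    -- Both integrals are within `ε / 2 * |μ|(A)` of `μ A * g(y⁻ * x)`.
    have hcont := continuous_translate hg hgc x
    have hI1 : ‖(∫ z, U.indicator (fun _ => c) z * evalConv g (inv z) x ∂lam) -
        μ A * evalConv g (inv y) x‖ ≤ ε / 2 * μ.variation.real A := by
      have e1 : ∫ z, U.indicator (fun _ => c) z * evalConv g (inv z) x ∂lam =
          ∫ z in U, c * evalConv g (inv z) x ∂lam := by
        rw [← integral_indicator hUm]
        congr 1
        ext z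
        by_cases hz : z ∈ U <;> simp [hz]
      have e2 : μ A * evalConv g (inv y) x = ∫ z in U, c * evalConv g (inv y) x ∂lam := by
        rw [setIntegral_const, ← hc, Complex.real_smul, mul_assoc]
      have hi : IntegrableOn (fun z => c * evalConv g (inv z) x) U lam := by
        have hconst : IntegrableOn (fun _ => c) U lam := integrableOn_const hUf
        exact integrable_mul_translate hg hgc hconst x
      rw [e1, e2, ← integral_sub hi (integrableOn_const hUf)]
      have hb := norm_setIntegral_le_of_norm_le_const (μ := lam) (s := U)
        (f := fun z => c * evalConv g (inv z) x - c * evalConv g (inv y) x)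
        (C := ‖c‖ * (ε / 2)) hUf.lt_top (fun z hz => by
          rw [← mul_sub, norm_mul]
          gcongr
          exact hclose z hz x)
      refine hb.trans ?_
      calc ‖c‖ * (ε / 2) * lam.real U = ε / 2 * (‖c‖ * lam.real U) := by ring
        _ ≤ ε / 2 * μ.variation.real A := by
          rw [hcn]
          gcongr
    have hI2 : ‖(μ.restrict A).integral (fun z => evalConv g (inv z) x)
        (ContinuousLinearMap.mul ℝ ℂ) - μ A * evalConv g (inv y) x‖ ≤
          ε / 2 * μ.variation.real A := by
      have e1 : μ A * evalConv g (inv y) x = (μ.restrict A).integral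
          (fun _ => evalConv g (inv y) x) (ContinuousLinearMap.mul ℝ ℂ) := by
        rw [VectorMeasure.integral_const]
        simp [VectorMeasure.restrict_apply, hA, mul_comm]
      have hi := integrable_translate hg hgc (μ.restrict A) x
      rw [e1, ← VectorMeasure.integral_fun_sub hi (integrable_const _)]
      have hb := VectorMeasure.norm_integral_le_of_norm_le_const (μ := μ.restrict A)
        (B := ContinuousLinearMap.mul ℝ ℂ)
        (f := fun z => evalConv g (inv z) x - evalConv g (inv y) x) (C := ε / 2) (by
          rw [VectorMeasure.variation_restrict hA]
          exact (ae_restrict_iff' hA).2 (Eventually.of_forall fun z hz => hclose z (hAU hz) x))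
      rw [VectorMeasure.variation_restrict hA, ContinuousLinearMap.opNorm_mul, mul_one,
        measureReal_restrict_apply_univ] at hb
      exact hb
    have h3 := norm_sub_le_norm_sub_add_norm_sub
      (∫ z, U.indicator (fun _ => c) z * evalConv g (inv z) x ∂lam)
      (μ A * evalConv g (inv y) x)
      ((μ.restrict A).integral (fun z => evalConv g (inv z) x) (ContinuousLinearMap.mul ℝ ℂ))
    rw [norm_sub_rev (μ A * evalConv g (inv y) x)] at h3
    linarith

/-- The local smearings of `exists_nhds_isSmearing` are added over a finite partition of a compact
set. The accuracy `ε` does not deteriorate, since the errors are proportional to the mass. -/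
theorem exists_isSmearing [lam.Regular] [lam.IsOpenPosMeasure] (hg : Continuous g)
    (hgc : HasCompactSupport g) (μ : ComplexMeasure K) [IsFiniteMeasure μ.variation] {C V : Set K}
    (hC : IsCompact C) (hV : IsCompact V) (hCV : C ⊆ interior V) {ε : ℝ} (hε : 0 < ε) :
    ∃ u, IsSmearing lam w g μ V ε C u := by
  obtain ⟨s, hs, -, h⟩ := hC.induction_on
    (p := fun s => ∃ s', s ⊆ s' ∧ MeasurableSet s' ∧ ∀ A ⊆ s', MeasurableSet A →
      ∃ u, IsSmearing lam w g μ V ε A u)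
    ⟨∅, subset_rfl, MeasurableSet.empty, fun A hA _ =>
      ⟨0, by rw [subset_empty_iff.1 hA]; exact IsSmearing.empty μ V ε⟩⟩
    (fun s t hst ⟨t', ht, h⟩ => ⟨t', hst.trans ht, h⟩)
    (fun s t ⟨s', hs, hs'm, hs'⟩ ⟨t', ht, ht'm, ht'⟩ =>
      ⟨s' ∪ t', union_subset_union hs ht, hs'm.union ht'm, fun A hA hAm => by
        obtain ⟨u, hu⟩ := hs' (A ∩ s') inter_subset_right (hAm.inter hs'm)
        obtain ⟨v, hv⟩ := ht' (A \ s') (fun x hx => (hA hx.1).resolve_left hx.2) (hAm.diff hs'm)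
        have huv := hu.union hg hgc hv (hAm.inter hs'm) (hAm.diff hs'm) disjoint_inf_sdiff
        rw [inter_union_sdiff] at huv
        exact ⟨_, huv⟩⟩)
    (fun y hy => by
      obtain ⟨U, hUo, hyU, hU⟩ := exists_nhds_isSmearing (lam := lam) (w := w) hg hgc μ hV (hCV hy) hε
      exact ⟨U, mem_nhdsWithin_of_mem_nhds (hUo.mem_nhds hyU), U, subset_rfl,
        hUo.measurableSet, hU⟩)
  exact h C hs hC.measurableSet

/-- A measure `μ` in the unit ball of `M_w(K)` is approximated by functions `u n` that imitate its
restrictions to larger and larger compact sets with more and more accuracy; they are in the ball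
of radius `2` of `L^1_w(K)`, and `u n * g` converges pointwise to `μ * g`. -/
theorem exists_measureConvolution_of_functionConvolution [lam.Regular] [lam.IsOpenPosMeasure]
    (hg : Continuous g) (hgc : HasCompactSupport g)
    (h : ∃ T : WeightedL1 lam w →L[ℂ] weightedOrlicz lam Φ w,
      IsFunctionConvolution g T ∧ IsCompactOperator T) :
    ∃ T : weightedMeasures w →L[ℂ] weightedOrlicz lam Φ w,
      IsMeasureConvolution g T ∧ IsCompactOperator T := by
  obtain ⟨T, hT, hTc⟩ := h
  obtain ⟨S, hS, hTS⟩ := IsCompactOperator.image_closedBall_subset_compact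
    (f := (T : WeightedL1 lam w →ₗ[ℂ] weightedOrlicz lam Φ w)) hTc 2
  obtain ⟨M, hM⟩ := hg.bounded_above_of_compact_support hgc
  have hfin : ∀ μ : weightedMeasures w, IsFiniteMeasure (μ : ComplexMeasure K).variation :=
    fun μ => μ.2.1.1
  have hint : ∀ (μ : weightedMeasures w) (x : K),
      (μ : ComplexMeasure K).Integrable fun y => evalConv g (inv y) x := fun μ x =>
    integrable_translate hg hgc _ x
  have hac := absolutelyContinuous_weight lam w
  suffices hex : ∃ T' : weightedMeasures w →L[ℂ] weightedOrlicz lam Φ w, IsCompactOperator T' ∧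
      ∀ μ, (T' μ : K →ₘ[lam] ℂ) =ᵐ[lam] fun x => (μ : ComplexMeasure K).integral
        (fun y => evalConv g (inv y) x) (ContinuousLinearMap.mul ℝ ℂ) by
    obtain ⟨T', hT'c, hT'⟩ := hex
    exact ⟨T', fun μ => by filter_upwards [hT' μ] with x hx using ⟨hint μ x, hx⟩, hT'c⟩
  refine exists_compact_operator
    (R := fun (μ : weightedMeasures w) x => (μ : ComplexMeasure K).integral
      (fun y => evalConv g (inv y) x) (ContinuousLinearMap.mul ℝ ℂ)) ?_ ?_ hS.closure ?_
  · exact fun μ ν => Eventually.of_forall fun x =>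
      VectorMeasure.integral_add_vectorMeasure (hint μ x) (hint ν x)
  · exact fun c μ => Eventually.of_forall fun x => integral_smul_complexMeasure c
      (continuous_translate hg hgc x).stronglyMeasurable (fun y => norm_evalConv_le hM _ _)
  · intro μ hμ
    set m := (μ : ComplexMeasure K).variation with hm
    have hmreg : m.Regular := μ.2.1.2
    obtain ⟨C, hCm, hC, hμC⟩ := exists_monotone_isCompact_exhaustion
      (integrable_const (μ := m) (1 : ℝ))
    replace hμC : ∀ᵐ y ∂m, ∃ n, y ∈ C n := by
      filter_upwards [hμC] with y hy using hy one_ne_zero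
    choose V hV hCV using fun n => exists_compact_superset (hC n)
    have hε : ∀ n : ℕ, 0 < 1 / ((n : ℝ) + 1) := fun n => Nat.one_div_pos_of_nat
    choose u hu using fun n => exists_isSmearing (lam := lam) (w := w) hg hgc
      (μ : ComplexMeasure K) (hC n) (hV n) (hCV n) (hε n)
    have hle : ∀ n, ∫⁻ y, ‖u n y‖ₑ ∂(lam.withDensity fun x => ENNReal.ofReal (w x)) ≤
        2 * ∫⁻ y, ENNReal.ofReal (w y) ∂m := by
      intro n
      rw [lintegral_withDensity_eq_lintegral_mul₀' w.measurable.aemeasurable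
        ((hu n).integrable.aestronglyMeasurable.mono_ac (withDensity_absolutelyContinuous _ _)).enorm]
      simp_rw [Pi.mul_apply, mul_comm (ENNReal.ofReal _)]
      refine (hu n).lintegral_le.trans ?_
      gcongr 2 * ?_
      exact setLIntegral_le_lintegral _ _
    have hfinw : 2 * ∫⁻ y, ENNReal.ofReal (w y) ∂m ≠ ∞ :=
      ENNReal.mul_ne_top (by simp) μ.2.2.ne
    have hui : ∀ n, Integrable (u n) (lam.withDensity fun x => ENNReal.ofReal (w x)) := fun n =>
      ⟨(hu n).integrable.aestronglyMeasurable.mono_ac (withDensity_absolutelyContinuous _ _),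
        (hle n).trans_lt hfinw.lt_top⟩
    let f : ℕ → WeightedL1 lam w := fun n => (hui n).toL1 (u n)
    have hfn : ∀ n, ‖f n‖ ≤ 2 := by
      intro n
      rw [Integrable.norm_toL1_eq_lintegral_enorm]
      refine (ENNReal.toReal_mono hfinw (hle n)).trans ?_
      rw [ENNReal.toReal_mul, ← weightedMeasures_norm_def]
      simpa using mul_le_mul_of_nonneg_left hμ zero_le_two
    have hTf : ∀ n, ∀ᵐ x ∂lam, (T (f n) : K →ₘ[lam] ℂ) x =
        ∫ y, u n y * evalConv g (inv y) x ∂lam := by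
      intro n
      filter_upwards [hT (f n)] with x hx
      rw [hx.2]
      refine integral_congr_ae ?_
      filter_upwards [hac.ae_le (hui n).coeFn_toL1] with y hy
      rw [hy]
    have hlim : ∀ᵐ x ∂lam, Tendsto (fun n => (T (f n) : K →ₘ[lam] ℂ) x) atTop
        (𝓝 ((μ : ComplexMeasure K).integral (fun y => evalConv g (inv y) x)
          (ContinuousLinearMap.mul ℝ ℂ))) := by
      filter_upwards [ae_all_iff.2 hTf] with x hx
      simp_rw [hx]
      have h1 : Tendsto (fun n => ((μ : ComplexMeasure K).restrict (C n)).integral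
          (fun y => evalConv g (inv y) x) (ContinuousLinearMap.mul ℝ ℂ)) atTop
          (𝓝 ((μ : ComplexMeasure K).integral (fun y => evalConv g (inv y) x)
            (ContinuousLinearMap.mul ℝ ℂ))) := by
        simp_rw [← VectorMeasure.integral_indicator (hC _).measurableSet]
        refine VectorMeasure.tendsto_integral_of_dominated_convergence (fun _ => M)
          (fun n => (continuous_translate hg hgc x).aestronglyMeasurable.indicator
            (hC n).measurableSet) (integrable_const M) (fun n => Eventually.of_forall fun y =>
              (norm_indicator_le_norm_self _ _).trans (norm_evalConv_le hM _ _)) ?_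
        filter_upwards [hμC] with y ⟨n, hn⟩
        refine tendsto_const_nhds.congr' ?_
        filter_upwards [eventually_ge_atTop n] with k hk
        rw [indicator_of_mem (hCm hk hn)]
      have h2 : Tendsto (fun n : ℕ => 1 / ((n : ℝ) + 1) * m.real univ) atTop (𝓝 0) := by
        simpa using tendsto_one_div_add_atTop_nhds_zero_nat.mul_const (m.real univ)
      have h3 := squeeze_zero_norm (fun n => ((hu n).norm_sub_le x).trans
        (mul_le_mul_of_nonneg_left (measureReal_mono (subset_univ _)) (hε n).le)) h2
      simpa using h3.add h1
    have hD := fun n => isCompact_biUnion_support (hC n) hgc.isCompact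
    obtain ⟨v, hv, hvS⟩ := exists_mem_closure_of_tendsto hS
      (fun n => hTS ⟨f n, by simpa using hfn n, rfl⟩) hlim
      (fun n => (hD n).measurableSet) (fun n => (hD n).measure_lt_top.ne) (fun x hx => by
        refine VectorMeasure.integral_eq_zero_of_ae ?_
        filter_upwards [hμC] with y ⟨n, hn⟩ using evalConv_inv_eq_zero_of_notMem hn (hx n))
    exact ⟨v, hvS, hv⟩

end Hypergroup

theorem mainTheorem6 {K : Type*} [TopologicalSpace K] [T2Space K] [LocallyCompactSpace K]
    [MeasurableSpace K] [BorelSpace K] [Hypergroup K]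
    (lam : Measure K) [lam.Regular] (hlam : Hypergroup.IsLeftInvariant lam)
    (Φ : YoungFunction) (w : Hypergroup.Weight K)
    (g : K → ℂ) (hg : Continuous g) (hgc : HasCompactSupport g) :
    (∃ T : Hypergroup.WeightedL1 lam w →L[ℂ] Hypergroup.weightedOrlicz lam Φ w,
      Hypergroup.IsFunctionConvolution g T ∧ IsCompactOperator T) ↔
    (∃ T : Hypergroup.weightedMeasures w →L[ℂ] Hypergroup.weightedOrlicz lam Φ w,
      Hypergroup.IsMeasureConvolution g T ∧ IsCompactOperator T) := by
  refine ⟨fun h => ?_,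
    Hypergroup.exists_functionConvolution_of_measureConvolution hg hgc⟩
  by_cases h0 : lam = 0
  -- Spreading masses over open sets needs `lam` to be nonzero; every function is a.e. zero otherwise.
  · subst h0
    exact ⟨0, fun μ => by simp, isCompactOperator_zero⟩
  · have := hlam.isOpenPosMeasure h0
    exact Hypergroup.exists_measureConvolution_of_functionConvolution hg hgc h
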